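/- Let $p$ be a prime number, let $F$ be a finite extension of $\mathbb{Q}_p$ with ring of integers $\mathcal{O}_F$, let $q$ be the cardinality of its residue field, and let $\|\cdot\|$ be the $p$-adic absolute value on $F$ normalized by $\|p\| = p^{-[F:\mathbb{Q}_p]}$. For an integer $n \ge 1$, let $\Omega_n \simeq \mathcal{O}_F^{n+1}$ be the space of polynomials of degree at most $n$ with coefficients in $\mathcal{O}_F$, equipped with the probability measure for which the $n+1$ coefficients are independent and distributed according to the Haar probability measure of $(\mathcal{O}_F,+)$. For an open subset $U$ of $F$, let $Z_{U,n}$ be the random variable on $\Omega_n$ that sends a polynomial $P$ to the number of its distinct roots in $U$; it is finite except at $P=0$. Let $U$ and $V$ be two disjoint balls (of positive radius) of $F$ contained in $\mathcal{O}_F$, let $u \in U$ and $v \in V$, and let $n \ge 3$. Then $Z_{U,n}$ and $Z_{V,n}$ are almost surely finite and square-integrable, with positive expectations, and $$\frac{\mathrm{Cov}(Z_{U,n},Z_{V,n})}{\mathbb{E}[Z_{U,n}]\cdot\mathbb{E}[Z_{V,n}]} = -1 + \frac{(q+1)^2}{q^2+q+1}\cdot\|u-v\| - \frac{q}{q^2+q+1}\cdot\|u-v\|^4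 .$$ Consequently $\mathrm{Cov}(Z_{U,n},Z_{V,n}) \le 0$, with equality if and only if $\|u-v\|=1$. -/

import Mathlib

open MeasureTheory ProbabilityTheory

namespace PadicRoots

noncomputable section

theorem norm_add_le_max (p : ℕ) [Fact p.Prime] (F : Type*) [NormedField F] [NormedAlgebra ℚ_[p] F]
    (x y : F) : ‖x + y‖ ≤ max ‖x‖ ‖y‖ :=
  (IsUltrametricDist.of_normedAlgebra ℚ_[p] (L := F)).norm_add_le_max x y

section Field

variable (p : ℕ) [Fact p.Prime] (F : Type*) [NormedField F] [NormedAlgebra ℚ_[p] F]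

/-- The ring of integers `O_F`: the elements of `F` of norm at most one. -/
def integers : ValuationSubring F where
  carrier := {x | ‖x‖ ≤ 1}
  mul_mem' {a b} ha hb := by
    simpa using mul_le_one₀ (show ‖a‖ ≤ 1 from ha) (norm_nonneg b) (show ‖b‖ ≤ 1 from hb)
  one_mem' := by simp
  add_mem' {a b} ha hb := (norm_add_le_max p F a b).trans (max_le ha hb)
  zero_mem' := by simp
  neg_mem' {a} ha := by simpa using ha
  mem_or_inv_mem' x := by
    rcases le_total ‖x‖ 1 with h | h
    · exact Or.inl h
    · exact Or.inr (by simpa using inv_le_one_of_one_le₀ h)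

/-- The cardinality `q` of the residue field of `F`. -/
def residueCard : ℕ := Nat.card (IsLocalRing.ResidueField (integers p F))

variable {F} in
/-- The absolute value of `F` normalized so that the value of `p` is `p ^ (-[F : ℚ_p])`. The norm
of `F` itself extends that of `ℚ_p`, so it takes the value `p⁻¹` at `p`. -/
def normalizedNorm (x : F) : ℝ := ‖x‖ ^ Module.finrank ℚ_[p] F

end Field

/-- `U` is a ball (open or closed, of positive radius). -/
def IsBall {F : Type*} [NormedField F] (U : Set F) : Prop :=
  ∃ (a : F) (r : ℝ), 0 < r ∧ (U = Metric.ball a r ∨ U = Metric.closedBall a r)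

section Measure

variable (p : ℕ) [Fact p.Prime] (F : Type*) [NormedField F] [NormedAlgebra ℚ_[p] F]
  [FiniteDimensional ℚ_[p] F]

/-- The closed unit ball `O_F` as a compact set with nonempty interior. -/
def unitBall : TopologicalSpace.PositiveCompacts F where
  carrier := Metric.closedBall 0 1
  isCompact' := by
    have := FiniteDimensional.proper ℚ_[p] F
    exact isCompact_closedBall 0 1
  interior_nonempty' :=
    ⟨0, Metric.ball_subset_interior_closedBall (Metric.mem_ball_self one_pos)⟩

variable [MeasurableSpace F] [BorelSpace F]

/-- The Haar measure of `(F, +)` normalized so that `O_F` has measure one. -/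
def haarMeasure : Measure F := Measure.addHaarMeasure (unitBall p F)

/-- The law of a random polynomial of degree at most `n` over `O_F`, described by its coefficients
(of `1, X, ..., X ^ n`): these are independent and Haar distributed on `O_F`. -/
def polyMeasure (n : ℕ) : Measure (Fin (n + 1) → integers p F) :=
  Measure.pi fun _ => (haarMeasure p F).comap Subtype.val

end Measure

section Roots

variable {p : ℕ} [Fact p.Prime] {F : Type*} [NormedField F] [NormedAlgebra ℚ_[p] F] {n : ℕ}

/-- The polynomial with the given coefficients, over `F`. -/
def toPoly (c : Fin (n + 1) → integers p F) : Polynomial F :=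
  ∑ i : Fin (n + 1), Polynomial.C (c i : F) * Polynomial.X ^ (i : ℕ)

/-- The number of roots in `U`, without multiplicity (`⊤` if there are infinitely many). -/
def rootCount (U : Set F) (c : Fin (n + 1) → integers p F) : ℕ∞ :=
  {x : F | x ∈ U ∧ (toPoly c).IsRoot x}.encard

/-- The random variable `Z_{U,n}` as a real-valued function. The value `⊤` of the count, which is
possible only for the zero polynomial, is replaced by `0`. -/
def Z (p : ℕ) [Fact p.Prime] {F : Type*} [NormedField F] [NormedAlgebra ℚ_[p] F]
    (U : Set F) (n : ℕ) : (Fin (n + 1) → integers p F) → ℝ :=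
  fun c => ((rootCount U c).toNat : ℝ)

end Roots

end

end PadicRoots

namespace PadicRoots

set_option linter.unusedSectionVars false

open Metric Set Filter Topology ENNReal Polynomial

/-- A normed ring that is the closed unit ball of a field: all norms are at most one, and
divisibility is governed by the norm. -/
class IsNormValuationRing (O : Type*) [NormedCommRing O] : Prop where
  norm_le_one : ∀ x : O, ‖x‖ ≤ 1
  dvd_of_norm_le : ∀ {a b : O}, ‖a‖ ≤ ‖b‖ → b ∣ a

section Scale

variable {O : Type*} [NormedCommRing O] [NormOneClass O] [NormMulClass O] [IsUltrametricDist O]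
  [CompactSpace O] [SecondCountableTopology O] [IsNormValuationRing O]

theorem norm_le_one (x : O) : ‖x‖ ≤ 1 := IsNormValuationRing.norm_le_one x

theorem norm_le_iff_dvd {a b : O} : ‖a‖ ≤ ‖b‖ ↔ b ∣ a := by
  refine ⟨IsNormValuationRing.dvd_of_norm_le, ?_⟩
  rintro ⟨c, rfl⟩
  rw [norm_mul]
  exact mul_le_of_le_one_right (norm_nonneg b) (norm_le_one c)

theorem range_mul_left (c : O) : range (fun x => c * x) = closedBall 0 ‖c‖ := by
  ext a
  simp only [mem_closedBall, dist_zero_right, norm_le_iff_dvd, mem_range]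
  exact ⟨fun ⟨y, h⟩ => ⟨y, h.symm⟩, fun ⟨y, h⟩ => ⟨y, h.symm⟩⟩

theorem isClosedEmbedding_mul_left {c : O} (hc : c ≠ 0) :
    IsClosedEmbedding (fun x : O => c * x) := by
  refine (by fun_prop : Continuous fun x : O => c * x).isClosedEmbedding ?_
  intro a b h
  have h' : ‖c‖ * ‖a - b‖ = 0 := by
    rw [← norm_mul, mul_sub, sub_eq_zero.2 h, norm_zero]
  rcases mul_eq_zero.1 h' with h | h
  · exact absurd (norm_eq_zero.1 h) hc
  · exact sub_eq_zero.1 (norm_eq_zero.1 h)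

variable [MeasurableSpace O] [BorelSpace O] (μ : Measure O) [IsProbabilityMeasure μ]
  [μ.IsAddHaarMeasure]

/-- The measure of the ideal generated by `c`. -/
noncomputable def scale (c : O) : ℝ≥0∞ := μ (closedBall 0 ‖c‖)

theorem measure_closedBall_norm (z c : O) : μ (closedBall z ‖c‖) = scale μ c := by
  have : closedBall z ‖c‖ = (fun x => z + x) '' closedBall 0 ‖c‖ := by
    simp
  rw [this, scale]
  simp only [image_add_left, measure_preimage_add]

theorem scale_of_norm_eq_one {c : O} (hc : ‖c‖ = 1) : scale μ c = 1 := by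
  rw [scale, hc, show closedBall (0 : O) 1 = univ from ?_, measure_univ]
  ext x
  simpa using norm_le_one x

theorem scale_le_one (c : O) : scale μ c ≤ 1 := prob_le_one

theorem scale_ne_top (c : O) : scale μ c ≠ ∞ := measure_ne_top _ _

theorem scale_mono {a b : O} (h : ‖a‖ ≤ ‖b‖) : scale μ a ≤ scale μ b :=
  measure_mono (closedBall_subset_closedBall h)

theorem scale_pos {c : O} (hc : c ≠ 0) : 0 < scale μ c :=
  measure_closedBall_pos μ _ (norm_pos_iff.2 hc)

theorem measurable_scale : Measurable (scale μ) := by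
  have : Monotone fun r : ℝ => μ (closedBall (0 : O) r) :=
    fun _ _ h => measure_mono (closedBall_subset_closedBall h)
  exact this.measurable.comp measurable_norm

theorem comap_mul_left {c : O} (hc : c ≠ 0) :
    μ.comap (fun x => c * x) = scale μ c • μ := by
  have he := isClosedEmbedding_mul_left hc
  have : (μ.comap (AddMonoidHom.mulLeft c)).IsAddLeftInvariant :=
    Measure.IsAddLeftInvariant.comap μ he.measurableEmbedding
  have hfin : IsFiniteMeasure (μ.comap (AddMonoidHom.mulLeft c)) := by
    constructor
    exact (he.measurableEmbedding.comap_apply μ univ).trans_lt (measure_lt_top _ _)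
  have h := Measure.isAddLeftInvariant_eq_smul (μ.comap (AddMonoidHom.mulLeft c)) μ
  have h' : μ.comap (fun x => c * x) =
      ((μ.comap (AddMonoidHom.mulLeft c)).addHaarScalarFactor μ : ℝ≥0∞) • μ := h
  have hu : scale μ c = ((μ.comap (AddMonoidHom.mulLeft c)).addHaarScalarFactor μ : ℝ≥0∞) := by
    have := congrArg (fun ν => ν univ) h'
    simp only [he.measurableEmbedding.comap_apply, image_univ, Measure.smul_apply, measure_univ,
      smul_eq_mul, mul_one, range_mul_left] at this
    exact this
  rw [h', hu]

theorem setLIntegral_closedBall_norm {c : O} (hc : c ≠ 0) (f : O → ℝ≥0∞) :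
    ∫⁻ x in closedBall 0 ‖c‖, f x ∂μ = scale μ c * ∫⁻ x, f (c * x) ∂μ := by
  have he := (isClosedEmbedding_mul_left hc).measurableEmbedding
  rw [← range_mul_left, ← he.map_comap, he.lintegral_map, comap_mul_left μ hc,
    lintegral_smul_measure, smul_eq_mul]

theorem scale_zero_of_tendsto {ϖ : O} (h : Tendsto (fun k : ℕ => scale μ (ϖ ^ k)) atTop (𝓝 0)) :
    scale μ (0 : O) = 0 := by
  refine le_antisymm (ge_of_tendsto' h fun k => scale_mono μ (by simp)) bot_le

theorem scale_mul (a b : O) (ha : a ≠ 0) : scale μ (a * b) = scale μ a * scale μ b := by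
  have he := (isClosedEmbedding_mul_left ha).measurableEmbedding
  have h := congrArg (fun ν => ν (closedBall 0 ‖b‖)) (comap_mul_left μ ha)
  simp only [he.comap_apply, Measure.smul_apply, smul_eq_mul] at h
  rw [scale, scale.eq_1 μ b, ← h]
  congr 1
  ext x
  constructor
  · intro hx
    rw [mem_closedBall, dist_zero_right, norm_le_iff_dvd] at hx
    obtain ⟨y, rfl⟩ := hx
    refine ⟨b * y, ?_, (mul_assoc _ _ _).symm⟩
    rw [mem_closedBall, dist_zero_right, norm_le_iff_dvd]
    exact dvd_mul_right _ _
  · rintro ⟨y, hy, rfl⟩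
    rw [mem_closedBall, dist_zero_right] at hy ⊢
    rw [norm_mul, norm_mul]
    gcongr

theorem scale_pow {a : O} (ha : a ≠ 0) (k : ℕ) : scale μ (a ^ k) = scale μ a ^ k := by
  induction k with
  | zero => simpa using scale_of_norm_eq_one μ (c := (1 : O)) (by simp)
  | succ k ih => rw [pow_succ', scale_mul μ _ _ ha, ih, pow_succ']

theorem scale_le_half {a : O} (ha : ‖a‖ < 1) : scale μ a ≤ 2⁻¹ := by
  have hd : Disjoint (closedBall (0 : O) ‖a‖) (closedBall 1 ‖a‖) := by
    rw [Set.disjoint_left]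
    intro x hx h'
    rw [mem_closedBall, dist_zero_right] at hx
    rw [mem_closedBall, dist_eq_norm] at h'
    have : ‖(1 : O)‖ ≤ ‖a‖ := by
      have := IsUltrametricDist.norm_add_le_max x (1 - x)
      rw [add_sub_cancel, norm_sub_rev] at this
      exact this.trans (max_le hx h')
    rw [norm_one] at this
    linarith
  have h := measure_union (μ := μ) hd measurableSet_closedBall
  rw [measure_closedBall_norm, measure_closedBall_norm] at h
  have h2 : scale μ a * 2 ≤ 1 := by
    rw [mul_two, ← h]
    exact prob_le_one
  rw [ENNReal.le_inv_iff_mul_le]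
  exact h2

theorem tendsto_scale_pow {a : O} (ha : a ≠ 0) (ha' : ‖a‖ < 1) :
    Tendsto (fun k : ℕ => scale μ (a ^ k)) atTop (𝓝 0) := by
  simp only [scale_pow μ ha]
  refine ENNReal.tendsto_pow_atTop_nhds_zero_of_lt_one ((scale_le_half μ ha').trans_lt ?_)
  simp

end Scale

section Moments

variable {O : Type*} [NormedCommRing O] [NormOneClass O] [NormMulClass O] [IsUltrametricDist O]
  [CompactSpace O] [SecondCountableTopology O] [IsNormValuationRing O]

/-- A generator of the maximal ideal, in terms of the norm. -/
structure IsUniformizer (ϖ : O) : Prop where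
  ne_zero : ϖ ≠ 0
  norm_lt_one : ‖ϖ‖ < 1
  norm_le : ∀ x : O, ‖x‖ < 1 → ‖x‖ ≤ ‖ϖ‖

theorem norm_add_eq_left {a b : O} (h : ‖b‖ < ‖a‖) : ‖a + b‖ = ‖a‖ := by
  rw [IsUltrametricDist.norm_add_eq_max_of_norm_ne_norm h.ne', max_eq_left h.le]

theorem IsUniformizer.exists_eq_pow_mul {ϖ : O} (hϖ : IsUniformizer ϖ) {δ : O} (hδ : δ ≠ 0) :
    ∃ (k : ℕ) (u : O), δ = ϖ ^ k * u ∧ ‖u‖ = 1 := by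
  have hfin : FiniteMultiplicity ϖ δ := by
    obtain ⟨n, hn⟩ := exists_pow_lt_of_lt_one (norm_pos_iff.2 hδ) hϖ.norm_lt_one
    refine ⟨n, fun h => ?_⟩
    rw [← norm_le_iff_dvd, norm_pow, pow_succ] at h
    have := mul_le_of_le_one_right (pow_nonneg (norm_nonneg ϖ) n) (norm_le_one ϖ)
    linarith
  obtain ⟨u, hu, hu'⟩ := hfin.exists_eq_pow_mul_and_not_dvd
  refine ⟨_, u, hu, le_antisymm (norm_le_one u) (not_lt.1 fun h => hu' ?_)⟩
  exact norm_le_iff_dvd.1 (hϖ.norm_le u h)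

theorem IsUniformizer.norm_eq_one_iff {ϖ : O} (hϖ : IsUniformizer ϖ) (x : O) :
    x ∈ (closedBall (0 : O) ‖ϖ‖)ᶜ ↔ ‖x‖ = 1 := by
  simp only [mem_compl_iff, mem_closedBall, dist_zero_right]
  constructor
  · intro h
    exact le_antisymm (norm_le_one x) (not_lt.1 fun h' => h (hϖ.norm_le x h'))
  · intro h
    rw [h]
    exact not_le.2 hϖ.norm_lt_one

variable [MeasurableSpace O] [BorelSpace O] (μ : Measure O) [IsProbabilityMeasure μ]
  [μ.IsAddHaarMeasure]

theorem lintegral_eq_add_of_ne_zero {ϖ : O} (hϖ : ϖ ≠ 0) (f : O → ℝ≥0∞) :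
    ∫⁻ x, f x ∂μ = ∫⁻ x in (closedBall 0 ‖ϖ‖)ᶜ, f x ∂μ + scale μ ϖ * ∫⁻ x, f (ϖ * x) ∂μ := by
  rw [← lintegral_add_compl f (measurableSet_closedBall (x := (0 : O)) (ε := ‖ϖ‖)), add_comm,
    setLIntegral_closedBall_norm μ hϖ]

theorem measure_compl_closedBall_norm (c : O) : μ (closedBall 0 ‖c‖)ᶜ = 1 - scale μ c := by
  rw [prob_compl_eq_one_sub measurableSet_closedBall, scale]

/-- The mean of the normalized absolute value. -/
noncomputable def meanScale : ℝ≥0∞ := ∫⁻ x, scale μ x ∂μ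

theorem meanScale_le_one : meanScale μ ≤ 1 := by
  refine (lintegral_mono fun x => scale_le_one μ x).trans ?_
  simp

theorem IsUniformizer.meanScale_eq {ϖ : O} (hϖ : IsUniformizer ϖ) :
    meanScale μ = (1 - scale μ ϖ) + scale μ ϖ * (scale μ ϖ * meanScale μ) := by
  conv_lhs => rw [meanScale, lintegral_eq_add_of_ne_zero μ hϖ.ne_zero]
  congr 1
  · rw [setLIntegral_congr_fun (g := fun _ => 1) measurableSet_closedBall.compl]
    · simp [measure_compl_closedBall_norm]
    · intro x hx
      exact scale_of_norm_eq_one μ ((hϖ.norm_eq_one_iff x).1 hx)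
  · simp only [scale_mul μ ϖ _ hϖ.ne_zero]
    rw [lintegral_const_mul _ (measurable_scale μ), meanScale]

theorem IsUniformizer.toReal_meanScale {ϖ : O} (hϖ : IsUniformizer ϖ) :
    (meanScale μ).toReal = 1 / (1 + (scale μ ϖ).toReal) := by
  have h := congrArg ENNReal.toReal (hϖ.meanScale_eq μ)
  have hm : meanScale μ ≠ ∞ := ((meanScale_le_one μ).trans_lt one_lt_top).ne
  have hw := scale_ne_top μ ϖ
  rw [toReal_add (by finiteness) (by finiteness), toReal_mul, toReal_mul,
    toReal_sub_of_le (scale_le_one μ ϖ) one_ne_top, toReal_one] at h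
  have hle := toReal_mono (by simp) (scale_le_half μ hϖ.norm_lt_one)
  have hnn : 0 ≤ (scale μ ϖ).toReal := toReal_nonneg
  rw [toReal_inv, toReal_ofNat] at hle
  generalize (scale μ ϖ).toReal = r at *
  generalize (meanScale μ).toReal = m at *
  have h1 : (1 - r) * (m * (1 + r) - 1) = 0 := by linear_combination h
  have h2 : m * (1 + r) - 1 = 0 := by
    rcases mul_eq_zero.1 h1 with h1 | h1
    · linarith
    · exact h1
  rw [_root_.eq_div_iff (by positivity)]
  linarith

/-- The mixed second moment of the normalized absolute values of two Haar distributed variables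
that are conditioned to be congruent modulo `δ`. -/
noncomputable def mixedMoment (δ : O) : ℝ≥0∞ :=
  ∫⁻ s, ∫⁻ t, scale μ s * scale μ (s + δ * t) ∂μ ∂μ

theorem mixedMoment_le_one (δ : O) : mixedMoment μ δ ≤ 1 := by
  refine (lintegral_mono fun s => lintegral_mono fun t =>
    mul_le_one' (scale_le_one μ s) (scale_le_one μ _)).trans ?_
  simp

theorem mixedMoment_of_norm_eq_one {δ : O} (hδ : ‖δ‖ = 1) :
    mixedMoment μ δ = meanScale μ * meanScale μ := by
  have hδ0 : δ ≠ 0 := norm_pos_iff.1 (by rw [hδ]; exact one_pos)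
  have key (f : O → ℝ≥0∞) : ∫⁻ t, f (δ * t) ∂μ = ∫⁻ t, f t ∂μ := by
    have := setLIntegral_closedBall_norm μ hδ0 f
    rw [scale_of_norm_eq_one μ hδ, one_mul] at this
    rw [← this, hδ, show closedBall (0 : O) 1 = univ from ?_, setLIntegral_univ]
    ext x
    simpa using norm_le_one x
  have h (s : O) : ∫⁻ t, scale μ s * scale μ (s + δ * t) ∂μ = scale μ s * meanScale μ := by
    rw [key fun t => scale μ s * scale μ (s + t),
      lintegral_const_mul' _ _ (scale_ne_top μ s),
      lintegral_add_left_eq_self (scale μ) s, meanScale]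
  rw [mixedMoment, lintegral_congr h, lintegral_mul_const _ (measurable_scale μ), meanScale]

theorem IsUniformizer.mixedMoment_mul {ϖ : O} (hϖ : IsUniformizer ϖ) (δ : O) :
    mixedMoment μ (ϖ * δ) = (1 - scale μ ϖ) + scale μ ϖ ^ 3 * mixedMoment μ δ := by
  rw [mixedMoment, lintegral_eq_add_of_ne_zero μ hϖ.ne_zero]
  congr 1
  · rw [setLIntegral_congr_fun (g := fun _ => 1) measurableSet_closedBall.compl]
    · simp [measure_compl_closedBall_norm]
    · intro s hs
      have hs1 := (hϖ.norm_eq_one_iff s).1 hs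
      have h (t : O) : scale μ s * scale μ (s + ϖ * δ * t) = 1 := by
        rw [scale_of_norm_eq_one μ hs1, scale_of_norm_eq_one μ, one_mul]
        rw [norm_add_eq_left, hs1]
        rw [hs1, mul_assoc]
        exact (norm_le_iff_dvd.2 (dvd_mul_right _ _)).trans_lt hϖ.norm_lt_one
      simp [h]
  · have h (s t : O) : scale μ (ϖ * s) * scale μ (ϖ * s + ϖ * δ * t) =
        scale μ ϖ ^ 2 * (scale μ s * scale μ (s + δ * t)) := by
      rw [mul_assoc ϖ, ← mul_add, scale_mul μ _ _ hϖ.ne_zero, scale_mul μ _ _ hϖ.ne_zero]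
      ring
    have hw : scale μ ϖ ^ 2 ≠ ∞ := ENNReal.pow_ne_top (scale_ne_top μ ϖ)
    simp only [h]
    simp_rw [lintegral_const_mul' (scale μ ϖ ^ 2) _ hw]
    rw [mixedMoment]
    ring

theorem IsUniformizer.toReal_mixedMoment {ϖ : O} (hϖ : IsUniformizer ϖ) {δ : O} (hδ : δ ≠ 0) :
    (mixedMoment μ δ).toReal =
      (1 - (scale μ δ).toReal ^ 3) / (1 + (scale μ ϖ).toReal + (scale μ ϖ).toReal ^ 2) +
        (scale μ δ).toReal ^ 3 / (1 + (scale μ ϖ).toReal) ^ 2 := by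
  obtain ⟨k, u, rfl, hu⟩ := hϖ.exists_eq_pow_mul hδ
  clear hδ
  have hr : 0 ≤ (scale μ ϖ).toReal := toReal_nonneg
  induction k with
  | zero =>
    rw [pow_zero, one_mul, mixedMoment_of_norm_eq_one μ hu, scale_of_norm_eq_one μ hu, toReal_mul,
      hϖ.toReal_meanScale μ]
    simp only [toReal_one]
    field_simp
    ring
  | succ k ih =>
    rw [pow_succ', mul_assoc, hϖ.mixedMoment_mul μ, scale_mul μ _ _ hϖ.ne_zero, toReal_mul]
    have hm : mixedMoment μ (ϖ ^ k * u) ≠ ∞ :=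
      ((mixedMoment_le_one μ _).trans_lt one_lt_top).ne
    have hw := scale_ne_top μ ϖ
    rw [toReal_add (by finiteness) (by finiteness), toReal_mul, toReal_pow, ih,
      toReal_sub_of_le (scale_le_one μ ϖ) one_ne_top, toReal_one]
    field_simp
    ring

end Moments

section NewtonHensel

variable {O : Type*} [NormedCommRing O] [NormOneClass O] [NormMulClass O] [IsUltrametricDist O]
  [CompactSpace O] [SecondCountableTopology O] [IsNormValuationRing O]

theorem norm_eval_sub_eval_le (P : O[X]) (x y : O) : ‖P.eval x - P.eval y‖ ≤ ‖x - y‖ := by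
  rw [norm_le_iff_dvd]
  exact sub_dvd_eval_sub x y P

/-- The approximate root condition under which a polynomial has exactly one root in the closed
ball of radius `‖e‖` around `x`. -/
def IsApproxRoot (P : O[X]) (e x : O) : Prop :=
  ‖e‖ < ‖P.derivative.eval x‖ ∧ ‖P.eval x‖ ≤ ‖e * P.derivative.eval x‖

theorem norm_derivative_eval_eq {P : O[X]} {e x y : O} (hx : ‖e‖ < ‖P.derivative.eval x‖)
    (hy : y ∈ closedBall x ‖e‖) : ‖P.derivative.eval y‖ = ‖P.derivative.eval x‖ := by
  rw [mem_closedBall, dist_eq_norm] at hy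
  have := norm_add_eq_left (((norm_eval_sub_eval_le P.derivative y x).trans hy).trans_lt hx)
  rwa [add_sub_cancel] at this

theorem IsApproxRoot.of_mem_closedBall {P : O[X]} {e x y : O} (hx : IsApproxRoot P e x)
    (hy : y ∈ closedBall x ‖e‖) : IsApproxRoot P e y := by
  have hd := norm_derivative_eval_eq hx.1 hy
  refine ⟨hd ▸ hx.1, ?_⟩
  rw [mem_closedBall, dist_eq_norm] at hy
  obtain ⟨k, hk⟩ := P.binomExpansion x (y - x)
  rw [add_sub_cancel] at hk
  rw [norm_mul, hd, ← norm_mul, hk]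
  refine (IsUltrametricDist.norm_add_le_max _ _).trans (max_le ?_ ?_)
  · refine (IsUltrametricDist.norm_add_le_max _ _).trans (max_le hx.2 ?_)
    rw [norm_mul, norm_mul, mul_comm]
    gcongr
  · rw [norm_mul, norm_pow, norm_mul]
    calc ‖k‖ * ‖y - x‖ ^ 2 ≤ 1 * ‖e‖ ^ 2 := by gcongr; exact norm_le_one k
      _ = ‖e‖ * ‖e‖ := by ring
      _ ≤ _ := by gcongr; exact hx.1.le

theorem eq_of_eval_eq_zero {P : O[X]} {e r s : O} (hr : P.eval r = 0) (hs : P.eval s = 0)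
    (hd : ‖e‖ < ‖P.derivative.eval r‖) (h : s ∈ closedBall r ‖e‖) : s = r := by
  rw [mem_closedBall, dist_eq_norm] at h
  obtain ⟨k, hk⟩ := P.binomExpansion r (s - r)
  rw [add_sub_cancel, hr, hs, zero_add] at hk
  have hne : ‖P.derivative.eval r + k * (s - r)‖ = ‖P.derivative.eval r‖ := by
    refine norm_add_eq_left ((norm_mul_le _ _).trans_lt (lt_of_le_of_lt ?_ hd))
    exact (mul_le_of_le_one_left (norm_nonneg _) (norm_le_one k)).trans h
  have h0 : ‖P.derivative.eval r + k * (s - r)‖ * ‖s - r‖ = 0 := by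
    rw [← norm_mul, norm_eq_zero, hk]
    ring
  rcases mul_eq_zero.1 h0 with h0 | h0
  · rw [hne] at h0
    exact absurd (norm_nonneg e) (by rw [not_le]; linarith)
  · exact sub_eq_zero.1 (norm_eq_zero.1 h0)

theorem IsApproxRoot.exists_root {P : O[X]} {e x : O} (hx : IsApproxRoot P e x) :
    ∃ r ∈ closedBall x ‖e‖, P.eval r = 0 := by
  obtain ⟨y, hy, hmin⟩ := (isClosed_closedBall (x := x) (ε := ‖e‖)).isCompact.exists_isMinOn
    ⟨x, mem_closedBall_self (norm_nonneg e)⟩ (f := fun y => ‖P.eval y‖) (by fun_prop)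
  refine ⟨y, hy, ?_⟩
  by_contra h0
  have hg := hx.of_mem_closedBall hy
  have hd0 : 0 < ‖P.derivative.eval y‖ := (norm_nonneg e).trans_lt hg.1
  obtain ⟨h, hh⟩ := norm_le_iff_dvd.1 hg.2
  set v := P.derivative.eval y
  have hev : P.eval y = v * (e * h) := by rw [hh]; ring
  have heh : ‖e * h‖ ≤ ‖e‖ := norm_le_iff_dvd.2 (dvd_mul_right _ _)
  have hpos : 0 < ‖e * h‖ := norm_pos_iff.2 fun h' => h0 (by rw [hev, h', mul_zero])
  have hmem : y - e * h ∈ closedBall x ‖e‖ := by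
    have : y - e * h ∈ closedBall y ‖e‖ := by
      rw [mem_closedBall, dist_eq_norm, sub_sub_cancel_left, norm_neg]
      exact heh
    exact IsUltrametricDist.closedBall_eq_of_mem hy ▸ this
  obtain ⟨k, hk⟩ := P.binomExpansion y (-(e * h))
  rw [← sub_eq_add_neg] at hk
  have hk' : P.eval (y - e * h) = k * (e * h) ^ 2 := by
    rw [hk, hev]
    ring
  have hle : ‖P.eval y‖ ≤ ‖P.eval (y - e * h)‖ := hmin hmem
  rw [hk', hev, norm_mul v, norm_mul k, norm_pow] at hle
  have : ‖k‖ * ‖e * h‖ ^ 2 ≤ ‖e‖ * ‖e * h‖ := by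
    calc ‖k‖ * ‖e * h‖ ^ 2 ≤ 1 * ‖e * h‖ ^ 2 := by gcongr; exact norm_le_one k
      _ = ‖e * h‖ * ‖e * h‖ := by ring
      _ ≤ _ := by gcongr
  have h2 : ‖e‖ * ‖e * h‖ < ‖v‖ * ‖e * h‖ := by
    gcongr
    exact hg.1
  linarith

instance isDomain_of_normMulClass : IsDomain O :=
  have : Nontrivial O := NormOneClass.nontrivial
  have : NoZeroDivisors O := NormMulClass.toNoZeroDivisors
  NoZeroDivisors.to_isDomain O

/-- The roots in `U` at which the derivative is larger than `e`. -/
def simpleRoots (P : O[X]) (e : O) (U : Set O) : Set O :=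
  {r | r ∈ U ∧ P.eval r = 0 ∧ ‖e‖ < ‖P.derivative.eval r‖}

theorem simpleRoots_subset_roots (P : O[X]) (e : O) (U : Set O) :
    simpleRoots P e U ⊆ P.rootSet O := by
  rintro r ⟨-, hr, hd⟩
  have hP : P ≠ 0 := by
    rintro rfl
    rw [derivative_zero, eval_zero, norm_zero] at hd
    exact absurd (norm_nonneg e) (not_le.2 hd)
  rw [mem_rootSet]
  exact ⟨hP, by simpa using hr⟩

theorem finite_simpleRoots (P : O[X]) (e : O) (U : Set O) : (simpleRoots P e U).Finite :=
  (rootSet_finite P O).subset (simpleRoots_subset_roots P e U)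

theorem ncard_simpleRoots_le (P : O[X]) (e : O) (U : Set O) :
    (simpleRoots P e U).ncard ≤ P.natDegree :=
  (ncard_le_ncard (simpleRoots_subset_roots P e U) (rootSet_finite P O)).trans
    (P.ncard_rootSet_le O)

theorem setOf_isApproxRoot_eq (P : O[X]) (e : O) {U : Set O}
    (hU : ∀ x ∈ U, closedBall x ‖e‖ ⊆ U) :
    {x | x ∈ U ∧ IsApproxRoot P e x} = ⋃ r ∈ simpleRoots P e U, closedBall r ‖e‖ := by
  ext x
  simp only [mem_ofPred_eq, mem_iUnion, exists_prop]
  constructor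
  · rintro ⟨hxU, hx⟩
    obtain ⟨r, hr, h0⟩ := hx.exists_root
    refine ⟨r, ⟨hU x hxU hr, h0, ?_⟩, mem_closedBall_comm.1 hr⟩
    rw [norm_derivative_eval_eq hx.1 hr]
    exact hx.1
  · rintro ⟨r, ⟨hrU, h0, hd⟩, hx⟩
    refine ⟨hU r hrU hx, IsApproxRoot.of_mem_closedBall ⟨hd, ?_⟩ hx⟩
    rw [h0, norm_zero]
    exact norm_nonneg _

theorem measure_setOf_isApproxRoot [MeasurableSpace O] [BorelSpace O] (μ : Measure O)
    [IsProbabilityMeasure μ] [μ.IsAddHaarMeasure] (P : O[X]) (e : O) {U : Set O}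
    (hU : ∀ x ∈ U, closedBall x ‖e‖ ⊆ U) :
    μ {x | x ∈ U ∧ IsApproxRoot P e x} = (simpleRoots P e U).ncard * scale μ e := by
  have hfin := finite_simpleRoots P e U
  rw [setOf_isApproxRoot_eq P e hU, ncard_eq_toFinset_card _ hfin]
  have : ⋃ r ∈ simpleRoots P e U, closedBall r ‖e‖ = ⋃ r ∈ hfin.toFinset, closedBall r ‖e‖ := by
    simp
  rw [this, measure_biUnion_finset]
  · simp [measure_closedBall_norm]
  · intro r hr s hs hrs
    rw [Function.onFun, Set.disjoint_left]
    intro x hxr hxs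
    rw [Finset.mem_coe, Finite.mem_toFinset] at hr hs
    refine hrs (eq_of_eval_eq_zero hs.2.1 hr.2.1 hs.2.2 ?_)
    rw [IsUltrametricDist.closedBall_eq_of_mem hxs]
    exact mem_closedBall_comm.1 hxr
  · exact fun _ _ => measurableSet_closedBall

end NewtonHensel

section DividedDifferences

variable {R : Type*} [CommRing R]

/-- The polynomial with given coefficients. -/
noncomputable def coeffPoly (n : ℕ) : (Fin (n + 1) → R) →ₗ[R] R[X] :=
  ∑ i : Fin (n + 1), (monomial (i : ℕ)).comp (LinearMap.proj i)

theorem coeffPoly_apply {n : ℕ} (c : Fin (n + 1) → R) :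
    coeffPoly n c = ∑ i : Fin (n + 1), monomial (i : ℕ) (c i) := by
  simp [coeffPoly]

theorem exists_coeffPoly_eq {n : ℕ} {P : R[X]} (hP : P.natDegree ≤ n) :
    ∃ c, coeffPoly n c = P := by
  refine ⟨fun i => P.coeff i, ?_⟩
  rw [coeffPoly_apply, Fin.sum_univ_eq_sum_range (fun i => monomial i (P.coeff i)) (n + 1)]
  exact (P.as_sum_range' (n + 1) (by omega)).symm

theorem natDegree_coeffPoly_le {n : ℕ} (c : Fin (n + 1) → R) : (coeffPoly n c).natDegree ≤ n := by
  rw [coeffPoly_apply]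
  refine natDegree_sum_le_of_forall_le _ _ fun i _ => ?_
  exact (natDegree_monomial_le _).trans (by omega)

theorem C_eval_add_mul_divByMonic (P : R[X]) (x : R) :
    C (P.eval x) + (X - C x) * (P /ₘ (X - C x)) = P := by
  have := modByMonic_add_div P (X - C x)
  rwa [modByMonic_X_sub_C_eq_C_eval] at this

theorem C_add_mul_divByMonic [Nontrivial R] (a x : R) (Q : R[X]) :
    (C a + (X - C x) * Q) /ₘ (X - C x) = Q := by
  refine (div_modByMonic_unique Q (C a) (monic_X_sub_C x) ⟨rfl, ?_⟩).1
  rw [degree_X_sub_C]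
  exact degree_C_lt

/-- The divided difference `(P - P(x)) / (X - x)`. -/
noncomputable def divDiff [Nontrivial R] (x : R) : R[X] →ₗ[R] R[X] where
  toFun P := P /ₘ (X - C x)
  map_add' P Q := by
    conv_lhs => rw [← C_eval_add_mul_divByMonic P x, ← C_eval_add_mul_divByMonic Q x]
    rw [← C_add_mul_divByMonic (P.eval x + Q.eval x) x (P /ₘ (X - C x) + Q /ₘ (X - C x))]
    congr 1
    rw [C_add]
    ring
  map_smul' r P := by
    conv_lhs => rw [← C_eval_add_mul_divByMonic P x]
    simp only [RingHom.id_apply]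
    rw [← C_add_mul_divByMonic (r * P.eval x) x (r • (P /ₘ (X - C x)))]
    congr 1
    rw [C_mul, smul_eq_C_mul, smul_eq_C_mul]
    ring

variable [Nontrivial R]

theorem divDiff_C_add_mul (a x : R) (Q : R[X]) : divDiff x (C a + (X - C x) * Q) = Q :=
  C_add_mul_divByMonic a x Q

theorem C_eval_add_mul_divDiff (P : R[X]) (x : R) : C (P.eval x) + (X - C x) * divDiff x P = P :=
  C_eval_add_mul_divByMonic P x

theorem eval_eq_divDiff (P : R[X]) (x y : R) :
    P.eval y = P.eval x + (y - x) * (divDiff x P).eval y := by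
  conv_lhs => rw [← C_eval_add_mul_divDiff P x]
  simp

theorem derivative_eval_eq_divDiff (P : R[X]) (x y : R) :
    P.derivative.eval y = (divDiff x P).eval y + (y - x) * (divDiff x P).derivative.eval y := by
  conv_lhs => rw [← C_eval_add_mul_divDiff P x]
  simp

/-- The Newton coordinates of order two with nodes `x, x`. -/
noncomputable def newtonTwo (n : ℕ) (x : R) : (Fin (n + 1) → R) →ₗ[R] R × R :=
  ((leval x).prod ((leval x).comp (divDiff x))).comp (coeffPoly n)

theorem newtonTwo_apply {n : ℕ} (x : R) (c : Fin (n + 1) → R) :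
    newtonTwo n x c = ((coeffPoly n c).eval x, (coeffPoly n c).derivative.eval x) := by
  rw [derivative_eval_eq_divDiff _ x]
  simp [newtonTwo, leval]

theorem newtonTwo_surjective {n : ℕ} (hn : 1 ≤ n) (x : R) :
    Function.Surjective (newtonTwo n x) := by
  rintro ⟨a, b⟩
  obtain ⟨c, hc⟩ := exists_coeffPoly_eq (n := n) (P := C a + (X - C x) * C b) (by
    refine le_trans ?_ hn
    compute_degree)
  refine ⟨c, ?_⟩
  simp [newtonTwo, hc, divDiff_C_add_mul, leval]

/-- The Newton coordinates of order four with nodes `x, y, x, y`: those of orders three and four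
come first. -/
noncomputable def newtonFour (n : ℕ) (x y : R) : (Fin (n + 1) → R) →ₗ[R] (R × R) × R × R :=
  ((((leval x).comp (divDiff y ∘ₗ divDiff x)).prod
    ((leval y).comp (divDiff x ∘ₗ divDiff y ∘ₗ divDiff x))).prod
    ((leval x).prod ((leval y).comp (divDiff x)))).comp (coeffPoly n)

theorem newtonFour_surjective {n : ℕ} (hn : 3 ≤ n) (x y : R) :
    Function.Surjective (newtonFour n x y) := by
  rintro ⟨⟨s, t⟩, a, b⟩
  obtain ⟨c, hc⟩ := exists_coeffPoly_eq (n := n)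
    (P := C a + (X - C x) * (C b + (X - C y) * (C s + (X - C x) * C t))) (by
    refine le_trans ?_ hn
    compute_degree)
  refine ⟨c, ?_⟩
  simp [newtonFour, hc, divDiff_C_add_mul, leval]

variable {n : ℕ} (x y : R) (c : Fin (n + 1) → R)

theorem eval_fst_eq_newtonFour : (coeffPoly n c).eval x = (newtonFour n x y c).2.1 := by
  simp [newtonFour, leval]

theorem eval_snd_eq_newtonFour : (coeffPoly n c).eval y =
    (newtonFour n x y c).2.1 + (y - x) * (newtonFour n x y c).2.2 := by
  rw [eval_eq_divDiff _ x y]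
  simp [newtonFour, leval]

theorem derivative_eval_fst_eq_newtonFour : (coeffPoly n c).derivative.eval x =
    (newtonFour n x y c).2.2 - (y - x) * (newtonFour n x y c).1.1 := by
  rw [derivative_eval_eq_divDiff _ x x, eval_eq_divDiff _ y x]
  simp [newtonFour, leval]
  ring

theorem derivative_eval_snd_eq_newtonFour : (coeffPoly n c).derivative.eval y =
    (newtonFour n x y c).2.2 +
      (y - x) * ((newtonFour n x y c).1.1 + (y - x) * (newtonFour n x y c).1.2) := by
  rw [derivative_eval_eq_divDiff _ x y, derivative_eval_eq_divDiff (divDiff x _) y y,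
    eval_eq_divDiff (divDiff y _) x y]
  simp [newtonFour, leval]

end DividedDifferences

section Laws

variable {O : Type*} [NormedCommRing O] [NormOneClass O] [NormMulClass O] [IsUltrametricDist O]
  [CompactSpace O] [SecondCountableTopology O] [IsNormValuationRing O]
  [MeasurableSpace O] [BorelSpace O] (μ : Measure O) [IsProbabilityMeasure μ]
  [μ.IsAddHaarMeasure]

theorem measurePreserving_newtonTwo {n : ℕ} (hn : 1 ≤ n) (x : O) :
    MeasurePreserving (newtonTwo n x) (Measure.pi fun _ => μ) (μ.prod μ) :=
  AddMonoidHom.measurePreserving (f := (newtonTwo n x).toAddMonoidHom)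
    (LinearMap.continuous_on_pi _) (newtonTwo_surjective hn x) (by simp)

theorem measurePreserving_newtonFour {n : ℕ} (hn : 3 ≤ n) (x y : O) :
    MeasurePreserving (newtonFour n x y) (Measure.pi fun _ => μ)
      ((μ.prod μ).prod (μ.prod μ)) :=
  have : ((μ.prod μ).prod (μ.prod μ)).IsAddHaarMeasure :=
    Measure.prod.instIsAddHaarMeasure (μ.prod μ) (μ.prod μ)
  AddMonoidHom.measurePreserving (f := (newtonFour n x y).toAddMonoidHom)
    (LinearMap.continuous_on_pi _) (newtonFour_surjective hn x y) (by simp)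

theorem continuous_eval_coeffPoly (n : ℕ) :
    Continuous fun z : (Fin (n + 1) → O) × O => (coeffPoly n z.1).eval z.2 := by
  simp only [coeffPoly_apply, eval_finsetSum, eval_monomial]
  fun_prop

theorem continuous_derivative_eval_coeffPoly (n : ℕ) :
    Continuous fun z : (Fin (n + 1) → O) × O => (coeffPoly n z.1).derivative.eval z.2 := by
  simp only [coeffPoly_apply, derivative_sum, eval_finsetSum, derivative_monomial, eval_monomial]
  fun_prop

end Laws

section FirstMoment

variable {O : Type*} [NormedCommRing O] [NormOneClass O] [NormMulClass O] [IsUltrametricDist O]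
  [CompactSpace O] [SecondCountableTopology O] [IsNormValuationRing O]
  [MeasurableSpace O] [BorelSpace O] (μ : Measure O) [IsProbabilityMeasure μ]
  [μ.IsAddHaarMeasure] {n : ℕ}

/-- The law of the coefficients of a random polynomial of degree at most `n`. -/
noncomputable abbrev coeffMeasure (n : ℕ) : Measure (Fin (n + 1) → O) := Measure.pi fun _ => μ

/-- The pairs of a polynomial and an approximate root. -/
def approxRootSet (n : ℕ) (e : O) : Set ((Fin (n + 1) → O) × O) :=
  {z | IsApproxRoot (coeffPoly n z.1) e z.2}

theorem measurableSet_approxRootSet (n : ℕ) (e : O) : MeasurableSet (approxRootSet n e) := by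
  have h0 := (continuous_eval_coeffPoly (O := O) n).measurable
  have h1 := (continuous_derivative_eval_coeffPoly (O := O) n).measurable
  exact (measurableSet_lt measurable_const h1.norm).inter
    (measurableSet_le h0.norm (h1.const_mul e).norm)

theorem measure_isApproxRoot (hn : 1 ≤ n) (e x : O) (he : e ≠ 0) :
    coeffMeasure μ n ((fun c => (c, x)) ⁻¹' approxRootSet n e) =
      scale μ e * ∫⁻ b, {b | ‖e‖ < ‖b‖}.indicator (scale μ) b ∂μ := by
  have hS : MeasurableSet {z : O × O | ‖e‖ < ‖z.2‖ ∧ ‖z.1‖ ≤ ‖e * z.2‖} :=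
    (measurableSet_lt measurable_const measurable_snd.norm).inter
      (measurableSet_le measurable_fst.norm (measurable_snd.const_mul e).norm)
  have h1 : (fun c => (c, x)) ⁻¹' approxRootSet n e =
      newtonTwo n x ⁻¹' {z | ‖e‖ < ‖z.2‖ ∧ ‖z.1‖ ≤ ‖e * z.2‖} := by
    ext c
    simp only [mem_ofPred_eq, mem_preimage, newtonTwo_apply, IsApproxRoot, approxRootSet]
  rw [h1, (measurePreserving_newtonTwo μ hn x).measure_preimage hS.nullMeasurableSet,
    Measure.prod_apply_symm hS, ← lintegral_const_mul' _ _ (scale_ne_top μ e)]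
  refine lintegral_congr fun b => ?_
  by_cases hb : ‖e‖ < ‖b‖
  · rw [indicator_of_mem (show b ∈ {b | ‖e‖ < ‖b‖} from hb), ← scale_mul μ _ _ he, scale]
    congr 1
    ext a
    simp [hb]
  · rw [indicator_of_notMem (show b ∉ {b | ‖e‖ < ‖b‖} from hb), mul_zero]
    convert measure_empty (μ := μ)
    ext a
    simp [hb]

theorem measure_exists_root_le (hn : 1 ≤ n) {e : O} (he : e ≠ 0) :
    coeffMeasure μ n {c | ∃ r, (coeffPoly n c).eval r = 0 ∧
      ‖(coeffPoly n c).derivative.eval r‖ ≤ ‖e‖} ≤ scale μ e ^ 2 := by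
  set T : Set ((Fin (n + 1) → O) × O) := {z | ‖(coeffPoly n z.1).derivative.eval z.2‖ ≤ ‖e‖ ∧
    ‖(coeffPoly n z.1).eval z.2‖ ≤ ‖e ^ 2‖} with hT
  have hTm : MeasurableSet T := by
    have h0 := (continuous_eval_coeffPoly (O := O) n).measurable
    have h1 := (continuous_derivative_eval_coeffPoly (O := O) n).measurable
    exact (measurableSet_le h1.norm measurable_const).inter
      (measurableSet_le h0.norm measurable_const)
  have hsub : {c | ∃ r, (coeffPoly n c).eval r = 0 ∧
      ‖(coeffPoly n c).derivative.eval r‖ ≤ ‖e‖} ⊆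
      {c | scale μ e ≤ μ (Prod.mk c ⁻¹' T)} := by
    rintro c ⟨r, hr, hd⟩
    rw [mem_ofPred_eq, ← measure_closedBall_norm μ r]
    refine measure_mono fun x hx => ?_
    rw [mem_closedBall, dist_eq_norm] at hx
    refine ⟨?_, ?_⟩
    · have := (norm_eval_sub_eval_le (coeffPoly n c).derivative x r).trans hx
      have h2 := IsUltrametricDist.norm_add_le_max
        ((coeffPoly n c).derivative.eval x - (coeffPoly n c).derivative.eval r)
        ((coeffPoly n c).derivative.eval r)
      rw [sub_add_cancel] at h2
      exact h2.trans (max_le this hd)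
    · obtain ⟨k, hk⟩ := (coeffPoly n c).binomExpansion r (x - r)
      rw [add_sub_cancel, hr, zero_add] at hk
      simp only [hk]
      refine (IsUltrametricDist.norm_add_le_max _ _).trans (max_le ?_ ?_)
      · rw [norm_mul, norm_pow, pow_two]
        gcongr
      · rw [norm_mul, norm_pow, norm_pow]
        calc ‖k‖ * ‖x - r‖ ^ 2 ≤ 1 * ‖e‖ ^ 2 := by gcongr; exact norm_le_one k
          _ = ‖e‖ ^ 2 := one_mul _
  have hint : ∫⁻ c, μ (Prod.mk c ⁻¹' T) ∂(coeffMeasure μ n) = scale μ e * scale μ (e ^ 2) := by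
    rw [← Measure.prod_apply hTm, Measure.prod_apply_symm hTm]
    have hx (x : O) : coeffMeasure μ n ((fun c => (c, x)) ⁻¹' T) =
        scale μ e * scale μ (e ^ 2) := by
      have h1 : (fun c => (c, x)) ⁻¹' T =
          newtonTwo n x ⁻¹' (closedBall 0 ‖e ^ 2‖ ×ˢ closedBall 0 ‖e‖) := by
        ext c
        simp [hT, newtonTwo_apply, and_comm]
      rw [h1, (measurePreserving_newtonTwo μ hn x).measure_preimage
        (measurableSet_closedBall.prod measurableSet_closedBall).nullMeasurableSet,
        Measure.prod_prod, mul_comm, scale, scale]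
    simp [hx]
  have h := mul_meas_ge_le_lintegral (μ := coeffMeasure μ n)
    (measurable_measure_prodMk_left (ν := μ) hTm) (scale μ e)
  rw [hint] at h
  rw [← scale_pow μ he]
  refine (measure_mono hsub).trans ?_
  exact (ENNReal.mul_le_mul_iff_right (scale_pos μ he).ne' (scale_ne_top μ e)).1 h

/-- The set of roots in `U`. -/
def rootsIn (P : O[X]) (U : Set O) : Set O := {r | r ∈ U ∧ P.eval r = 0}

theorem ae_eventually_simpleRoots_eq (hn : 1 ≤ n) {ϖ : O} (hϖ : ϖ ≠ 0) (hϖ' : ‖ϖ‖ < 1) :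
    ∀ᵐ c ∂(coeffMeasure μ n), coeffPoly n c ≠ 0 ∧
      ∀ᶠ k : ℕ in atTop, ∀ U, simpleRoots (coeffPoly n c) (ϖ ^ k) U =
        rootsIn (coeffPoly n c) U := by
  set B : ℕ → Set (Fin (n + 1) → O) := fun k => {c | ∃ r, (coeffPoly n c).eval r = 0 ∧
      ‖(coeffPoly n c).derivative.eval r‖ ≤ ‖ϖ ^ k‖} with hB
  have hnull : coeffMeasure μ n (⋂ k, B k) = 0 := by
    have hlim : Tendsto (fun k : ℕ => scale μ (ϖ ^ k) ^ 2) atTop (𝓝 0) := by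
      simpa [Function.comp_def] using
        ((ENNReal.continuous_pow 2).tendsto 0).comp (tendsto_scale_pow μ hϖ hϖ')
    refine le_antisymm (ge_of_tendsto' hlim fun k => ?_) bot_le
    exact (measure_mono (iInter_subset _ k)).trans
      (measure_exists_root_le μ hn (pow_ne_zero k hϖ))
  filter_upwards [measure_eq_zero_iff_ae_notMem.1 hnull] with c hc
  rw [mem_iInter, not_forall] at hc
  obtain ⟨k, hk⟩ := hc
  have hk' : ∀ r, (coeffPoly n c).eval r = 0 →
      ‖ϖ ^ k‖ < ‖(coeffPoly n c).derivative.eval r‖ := by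
    intro r hr
    by_contra h
    exact hk ⟨r, hr, not_lt.1 h⟩
  refine ⟨?_, ?_⟩
  · intro h0
    have := hk' 0 (by simp [h0])
    rw [h0, derivative_zero, eval_zero, norm_zero] at this
    exact absurd (norm_nonneg _) (not_le.2 this)
  · filter_upwards [eventually_ge_atTop k] with l hl U
    ext r
    refine ⟨fun h => ⟨h.1, h.2.1⟩, fun h => ⟨h.1, h.2, lt_of_le_of_lt ?_ (hk' r h.2)⟩⟩
    rw [norm_pow, norm_pow]
    exact pow_le_pow_of_le_one (norm_nonneg _) hϖ'.le hl

theorem ncard_simpleRoots_mul_scale (c : Fin (n + 1) → O) (e : O) {U : Set O}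
    (hU : ∀ x ∈ U, closedBall x ‖e‖ ⊆ U) :
    ((simpleRoots (coeffPoly n c) e U).ncard : ℝ≥0∞) * scale μ e =
      μ.restrict U (Prod.mk c ⁻¹' approxRootSet n e) := by
  rw [← measure_setOf_isApproxRoot μ _ e hU,
    Measure.restrict_apply (measurable_prodMk_left (measurableSet_approxRootSet n e))]
  congr 1
  ext x
  simp [and_comm, approxRootSet]

include μ in
theorem measurable_ncard_simpleRoots (n : ℕ) {e : O} (he : e ≠ 0) {U : Set O}
    (hU : ∀ x ∈ U, closedBall x ‖e‖ ⊆ U) :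
    Measurable fun c : Fin (n + 1) → O => ((simpleRoots (coeffPoly n c) e U).ncard : ℝ≥0∞) := by
  have h : (fun c : Fin (n + 1) → O => ((simpleRoots (coeffPoly n c) e U).ncard : ℝ≥0∞)) =
      fun c => μ.restrict U (Prod.mk c ⁻¹' approxRootSet n e) / scale μ e := by
    ext c
    rw [← ncard_simpleRoots_mul_scale μ c e hU,
      ENNReal.mul_div_cancel_right (scale_pos μ he).ne' (scale_ne_top μ e)]
  rw [h]
  exact (measurable_measure_prodMk_left (measurableSet_approxRootSet n e)).div_const _

theorem lintegral_ncard_simpleRoots (hn : 1 ≤ n) {e : O} (he : e ≠ 0) {U : Set O}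
    (hU : ∀ x ∈ U, closedBall x ‖e‖ ⊆ U) :
    ∫⁻ c, ((simpleRoots (coeffPoly n c) e U).ncard : ℝ≥0∞) ∂(coeffMeasure μ n) =
      μ U * ∫⁻ b, {b | ‖e‖ < ‖b‖}.indicator (scale μ) b ∂μ := by
  have hm := measurableSet_approxRootSet (O := O) n e
  rw [← ENNReal.mul_left_inj (scale_pos μ he).ne' (scale_ne_top μ e),
    ← lintegral_mul_const' _ _ (scale_ne_top μ e)]
  simp_rw [ncard_simpleRoots_mul_scale μ _ e hU]
  rw [← Measure.prod_apply hm, Measure.prod_apply_symm hm,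
    lintegral_congr fun x => measure_isApproxRoot μ hn e x he, lintegral_const,
    Measure.restrict_apply_univ]
  ring

theorem scale_zero {ϖ : O} (hϖ : ϖ ≠ 0) (hϖ' : ‖ϖ‖ < 1) : scale μ (0 : O) = 0 :=
  scale_zero_of_tendsto μ (tendsto_scale_pow μ hϖ hϖ')

theorem tendsto_norm_pow_zero {ϖ : O} (hϖ' : ‖ϖ‖ < 1) :
    Tendsto (fun k : ℕ => ‖ϖ ^ k‖) atTop (𝓝 0) := by
  simpa only [norm_pow] using tendsto_pow_atTop_nhds_zero_of_lt_one (norm_nonneg ϖ) hϖ'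

theorem tendsto_lintegral_indicator_scale {ϖ : O} (hϖ : ϖ ≠ 0) (hϖ' : ‖ϖ‖ < 1) :
    Tendsto (fun k : ℕ => ∫⁻ b, {b | ‖ϖ ^ k‖ < ‖b‖}.indicator (scale μ) b ∂μ) atTop
      (𝓝 (meanScale μ)) := by
  refine tendsto_lintegral_of_dominated_convergence (fun _ => 1)
    (fun k => (measurable_scale μ).indicator (measurableSet_lt measurable_const measurable_norm))
    (fun k => ae_of_all _ fun b => ?_) (by simp) (ae_of_all _ fun b => ?_)
  · exact (indicator_le_self _ _ b).trans (scale_le_one μ b)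
  · by_cases hb : b = 0
    · subst hb
      rw [scale_zero μ hϖ hϖ']
      refine tendsto_const_nhds.congr fun k => ?_
      simp
    · refine tendsto_const_nhds.congr' ?_
      filter_upwards [(tendsto_norm_pow_zero hϖ').eventually_lt_const (norm_pos_iff.2 hb)] with k hk
      rw [indicator_of_mem (show b ∈ {b | ‖ϖ ^ k‖ < ‖b‖} from hk)]

/-- A set that is a union of balls of a common radius. -/
def IsUniformlyOpen (U : Set O) : Prop := ∃ ε > 0, ∀ x ∈ U, closedBall x ε ⊆ U

theorem IsUniformlyOpen.eventually {U : Set O} (hU : IsUniformlyOpen U) {ϖ : O} (hϖ' : ‖ϖ‖ < 1) :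
    ∀ᶠ k : ℕ in atTop, ∀ x ∈ U, closedBall x ‖ϖ ^ k‖ ⊆ U := by
  obtain ⟨ε, hε, h⟩ := hU
  filter_upwards [(tendsto_norm_pow_zero hϖ').eventually_lt_const hε] with k hk x hx
  exact (closedBall_subset_closedBall hk.le).trans (h x hx)

theorem rootsIn_subset_rootSet {P : O[X]} (hP : P ≠ 0) (U : Set O) : rootsIn P U ⊆ P.rootSet O := by
  rintro r ⟨-, hr⟩
  rw [mem_rootSet]
  exact ⟨hP, by simpa using hr⟩

theorem finite_rootsIn {P : O[X]} (hP : P ≠ 0) (U : Set O) : (rootsIn P U).Finite :=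
  (rootSet_finite P O).subset (rootsIn_subset_rootSet hP U)

theorem ncard_rootsIn_le {c : Fin (n + 1) → O} (hc : coeffPoly n c ≠ 0) (U : Set O) :
    (rootsIn (coeffPoly n c) U).ncard ≤ n :=
  ((ncard_le_ncard (rootsIn_subset_rootSet hc U) (rootSet_finite _ O)).trans
    (ncard_rootSet_le _ O)).trans (natDegree_coeffPoly_le c)

theorem lintegral_ncard_rootsIn (hn : 1 ≤ n) {ϖ : O} (hϖ : ϖ ≠ 0) (hϖ' : ‖ϖ‖ < 1) {U : Set O}
    (hU : IsUniformlyOpen U) :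
    ∫⁻ c, ((rootsIn (coeffPoly n c) U).ncard : ℝ≥0∞) ∂(coeffMeasure μ n) = μ U * meanScale μ := by
  obtain ⟨K, hK⟩ := eventually_atTop.1 (hU.eventually hϖ')
  have h1 : Tendsto (fun k : ℕ => ∫⁻ c, ((simpleRoots (coeffPoly n c) (ϖ ^ (k + K)) U).ncard : ℝ≥0∞)
      ∂(coeffMeasure μ n)) atTop
      (𝓝 (∫⁻ c, ((rootsIn (coeffPoly n c) U).ncard : ℝ≥0∞) ∂(coeffMeasure μ n))) := by
    refine tendsto_lintegral_of_dominated_convergence (fun _ => (n : ℝ≥0∞))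
      (fun k => measurable_ncard_simpleRoots μ n (pow_ne_zero _ hϖ) (hK _ (by omega)))
      (fun k => ae_of_all _ fun c => ?_) (by simp) ?_
    · exact Nat.cast_le.2 ((ncard_simpleRoots_le _ _ _).trans (natDegree_coeffPoly_le c))
    · filter_upwards [ae_eventually_simpleRoots_eq μ hn hϖ hϖ'] with c hc
      refine tendsto_const_nhds.congr' ?_
      filter_upwards [(tendsto_add_atTop_nat K).eventually hc.2] with k hk
      rw [hk]
  have h2 : ∀ k : ℕ, ∫⁻ c, ((simpleRoots (coeffPoly n c) (ϖ ^ (k + K)) U).ncard : ℝ≥0∞)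
      ∂(coeffMeasure μ n) = μ U * ∫⁻ b, {b | ‖ϖ ^ (k + K)‖ < ‖b‖}.indicator (scale μ) b ∂μ :=
    fun k => lintegral_ncard_simpleRoots μ hn (pow_ne_zero _ hϖ) (hK _ (by omega))
  simp_rw [h2] at h1
  refine tendsto_nhds_unique h1 (ENNReal.Tendsto.const_mul ?_ (Or.inr (measure_ne_top _ _)))
  exact (tendsto_lintegral_indicator_scale μ hϖ hϖ').comp (tendsto_add_atTop_nat K)

end FirstMoment

section SecondMoment

variable {O : Type*} [NormedCommRing O] [NormOneClass O] [NormMulClass O] [IsUltrametricDist O]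
  [CompactSpace O] [SecondCountableTopology O] [IsNormValuationRing O]
  [MeasurableSpace O] [BorelSpace O] (μ : Measure O) [IsProbabilityMeasure μ]
  [μ.IsAddHaarMeasure] {n : ℕ}

/-- The conditions for `x` and `x + δ` to be approximate roots, in the Newton coordinates
`((s, t), (a, b))` with nodes `x, x + δ, x, x + δ`. -/
def jointApproxSet (e δ : O) : Set ((O × O) × O × O) :=
  {z | (‖e‖ < ‖z.2.2 - δ * z.1.1‖ ∧ ‖z.2.1‖ ≤ ‖e * (z.2.2 - δ * z.1.1)‖) ∧
    ‖e‖ < ‖z.2.2 + δ * (z.1.1 + δ * z.1.2)‖ ∧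
    ‖z.2.1 + δ * z.2.2‖ ≤ ‖e * (z.2.2 + δ * (z.1.1 + δ * z.1.2))‖}

theorem measurableSet_jointApproxSet (e δ : O) : MeasurableSet (jointApproxSet e δ) := by
  have h1 : Measurable fun z : (O × O) × O × O => z.2.2 - δ * z.1.1 :=
    (by fun_prop : Continuous _).measurable
  have h2 : Measurable fun z : (O × O) × O × O => z.2.2 + δ * (z.1.1 + δ * z.1.2) :=
    (by fun_prop : Continuous _).measurable
  have h3 : Measurable fun z : (O × O) × O × O => z.2.1 + δ * z.2.2 :=
    (by fun_prop : Continuous _).measurable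
  have h4 : Measurable fun z : (O × O) × O × O => z.2.1 :=
    (by fun_prop : Continuous _).measurable
  exact ((measurableSet_lt measurable_const h1.norm).inter
    (measurableSet_le h4.norm (h1.const_mul e).norm)).inter
    ((measurableSet_lt measurable_const h2.norm).inter
    (measurableSet_le h3.norm (h2.const_mul e).norm))

theorem measure_mul_le (e : O) {δ : O} (hδ : δ ≠ 0) :
    scale μ δ * μ {b | ‖δ * b‖ ≤ ‖e‖} ≤ scale μ e := by
  have he := (isClosedEmbedding_mul_left hδ).measurableEmbedding
  have h := congrArg (fun ν => ν {b | ‖δ * b‖ ≤ ‖e‖}) (comap_mul_left μ hδ)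
  simp only [he.comap_apply, Measure.smul_apply, smul_eq_mul] at h
  rw [← h]
  refine measure_mono ?_
  rintro _ ⟨b, hb, rfl⟩
  simpa using hb

theorem measure_slice_jointApproxSet_le (e : O) {δ : O} (hδ : δ ≠ 0) (z : O × O) :
    scale μ δ * (μ.prod μ) (Prod.mk z ⁻¹' jointApproxSet e δ) ≤ scale μ e ^ 2 := by
  have hsub : Prod.mk z ⁻¹' jointApproxSet e δ ⊆ closedBall 0 ‖e‖ ×ˢ {b | ‖δ * b‖ ≤ ‖e‖} := by
    rintro ⟨a, b⟩ ⟨⟨-, h1⟩, -, h2⟩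
    have h1' : ‖a‖ ≤ ‖e‖ := h1.trans (norm_le_iff_dvd.2 (dvd_mul_right _ _))
    have h2' : ‖a + δ * b‖ ≤ ‖e‖ := h2.trans (norm_le_iff_dvd.2 (dvd_mul_right _ _))
    refine ⟨by simpa using h1', ?_⟩
    have := IsUltrametricDist.norm_add_le_max (a + δ * b) (-a)
    rw [norm_neg, add_neg_cancel_comm] at this
    exact this.trans (max_le h2' h1')
  calc scale μ δ * (μ.prod μ) (Prod.mk z ⁻¹' jointApproxSet e δ)
      ≤ scale μ δ * (scale μ e * μ {b | ‖δ * b‖ ≤ ‖e‖}) := by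
        gcongr
        refine (measure_mono hsub).trans ?_
        rw [Measure.prod_prod, scale]
    _ = scale μ e * (scale μ δ * μ {b | ‖δ * b‖ ≤ ‖e‖}) := by ring
    _ ≤ scale μ e * scale μ e := by
        gcongr
        exact measure_mul_le μ e hδ
    _ = scale μ e ^ 2 := (pow_two _).symm

theorem measure_prod_congruent {δ : O} (hδ : δ ≠ 0) (u v : O) :
    (μ.prod μ) {z | ‖z.1‖ ≤ ‖δ * u‖ ∧ ‖z.1 + δ * z.2‖ ≤ ‖δ * v‖} =
      scale μ (δ * u) * scale μ v := by
  have hm : MeasurableSet {z : O × O | ‖z.1‖ ≤ ‖δ * u‖ ∧ ‖z.1 + δ * z.2‖ ≤ ‖δ * v‖} := by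
    have h : Measurable fun z : O × O => z.1 + δ * z.2 := (by fun_prop : Continuous _).measurable
    exact (measurableSet_le measurable_fst.norm measurable_const).inter
      (measurableSet_le h.norm measurable_const)
  rw [Measure.prod_apply hm]
  have h (a : O) : μ (Prod.mk a ⁻¹' {z | ‖z.1‖ ≤ ‖δ * u‖ ∧ ‖z.1 + δ * z.2‖ ≤ ‖δ * v‖}) =
      (closedBall 0 ‖δ * u‖).indicator (fun _ => scale μ v) a := by
    by_cases ha : ‖a‖ ≤ ‖δ * u‖
    · rw [indicator_of_mem (by simpa using ha)]
      obtain ⟨a', rfl⟩ := norm_le_iff_dvd.1 (ha.trans (norm_le_iff_dvd.2 (dvd_mul_right δ u)))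
      rw [← measure_closedBall_norm μ (-a') v]
      congr 1
      ext b
      have hp : 0 < ‖δ‖ := norm_pos_iff.2 hδ
      simp only [preimage_ofPred_eq, mem_ofPred_eq, mem_closedBall, dist_eq_norm,
        ← mul_add, norm_mul δ, sub_neg_eq_add, add_comm b, mul_le_mul_iff_right₀ hp] at ha ⊢
      exact and_iff_right ha
    · rw [indicator_of_notMem (by simpa using ha)]
      convert measure_empty (μ := μ)
      ext b
      exact iff_of_false (fun h => ha h.1) (notMem_empty b)
  rw [lintegral_congr h, lintegral_indicator_const measurableSet_closedBall, mul_comm,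
    scale.eq_1 μ (δ * u)]

theorem measure_slice_jointApproxSet {e δ s t : O} (he : e ≠ 0) (hδ : δ ≠ 0)
    (hs : ‖e‖ < ‖δ * (δ * s)‖) (ht : ‖e‖ < ‖δ * (δ * (s + δ * t))‖) :
    (μ.prod μ) (Prod.mk (s, t) ⁻¹' jointApproxSet e δ) =
      scale μ e ^ 2 * (scale μ δ * (scale μ s * scale μ (s + δ * t))) := by
  have hle (a b : O) : ‖a * b‖ ≤ ‖a‖ := norm_le_iff_dvd.2 (dvd_mul_right a b)
  have hle' (a b : O) : ‖a * b‖ ≤ ‖b‖ := norm_le_iff_dvd.2 (dvd_mul_left b a)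
  have hp : 0 < ‖δ‖ := norm_pos_iff.2 hδ
  have key : ∀ a b : O, ‖a‖ ≤ ‖e‖ → ‖a + δ * b‖ ≤ ‖e‖ →
      ‖b - δ * s‖ = ‖δ * s‖ ∧ ‖b + δ * (s + δ * t)‖ = ‖δ * (s + δ * t)‖ := by
    intro a b ha hab
    have hb : ‖δ * b‖ ≤ ‖e‖ := by
      have := IsUltrametricDist.norm_add_le_max (a + δ * b) (-a)
      rw [norm_neg, add_neg_cancel_comm] at this
      exact this.trans (max_le hab ha)
    have h1 : ‖b‖ < ‖δ * s‖ := by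
      have := hb.trans_lt hs
      rwa [norm_mul, norm_mul, mul_lt_mul_iff_right₀ hp] at this
    have h2 : ‖b‖ < ‖δ * (s + δ * t)‖ := by
      have := hb.trans_lt ht
      rwa [norm_mul, norm_mul, mul_lt_mul_iff_right₀ hp] at this
    refine ⟨?_, ?_⟩
    · rw [norm_sub_rev, sub_eq_add_neg, norm_add_eq_left]
      rwa [norm_neg]
    · rw [add_comm, norm_add_eq_left h2]
  have hset : Prod.mk (s, t) ⁻¹' jointApproxSet e δ =
      {z | ‖z.1‖ ≤ ‖δ * (e * s)‖ ∧ ‖z.1 + δ * z.2‖ ≤ ‖δ * (e * (s + δ * t))‖} := by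
    have e1 (u : O) : δ * (e * u) = e * (δ * u) := by ring
    ext ⟨a, b⟩
    simp only [jointApproxSet, preimage_ofPred_eq, mem_ofPred_eq, e1]
    constructor
    · rintro ⟨⟨-, h1⟩, -, h2⟩
      obtain ⟨k1, k2⟩ := key a b (h1.trans (hle _ _)) (h2.trans (hle _ _))
      rw [norm_mul, k1, ← norm_mul] at h1
      rw [norm_mul, k2, ← norm_mul] at h2
      exact ⟨h1, h2⟩
    · rintro ⟨h1, h2⟩
      obtain ⟨k1, k2⟩ := key a b (h1.trans (hle _ _)) (h2.trans (hle _ _))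
      rw [norm_mul e, norm_mul e, k1, k2, ← norm_mul, ← norm_mul]
      exact ⟨⟨hs.trans_le (hle' _ _), h1⟩, ht.trans_le (hle' _ _), h2⟩
  rw [hset, measure_prod_congruent μ hδ, scale_mul μ _ _ hδ, scale_mul μ _ _ he,
    scale_mul μ _ _ he]
  ring

theorem measure_pair_approxRootSet (hn : 3 ≤ n) (e x y : O) :
    coeffMeasure μ n ((fun c => (c, x)) ⁻¹' approxRootSet n e ∩
      (fun c => (c, y)) ⁻¹' approxRootSet n e) =
    ∫⁻ z, (μ.prod μ) (Prod.mk z ⁻¹' jointApproxSet e (y - x)) ∂(μ.prod μ) := by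
  rw [← Measure.prod_apply (measurableSet_jointApproxSet e (y - x)),
    ← (measurePreserving_newtonFour μ hn x y).measure_preimage
      (measurableSet_jointApproxSet e (y - x)).nullMeasurableSet]
  congr 1
  ext c
  simp only [approxRootSet, IsApproxRoot, jointApproxSet, mem_inter_iff, mem_preimage,
    mem_ofPred_eq]
  rw [← eval_fst_eq_newtonFour, derivative_eval_snd_eq_newtonFour x y,
    derivative_eval_fst_eq_newtonFour x y, eval_snd_eq_newtonFour x y,
    ← eval_fst_eq_newtonFour]

theorem lintegral_slice_jointApproxSet_le (e : O) {δ : O} (hδ : δ ≠ 0) :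
    (∫⁻ z, (μ.prod μ) (Prod.mk z ⁻¹' jointApproxSet e δ) ∂(μ.prod μ)) ≤
      scale μ e ^ 2 / scale μ δ := by
  refine (lintegral_mono (g := fun _ => scale μ e ^ 2 / scale μ δ) fun z => ?_).trans (by simp)
  rw [ENNReal.le_div_iff_mul_le (Or.inl (scale_pos μ hδ).ne') (Or.inl (scale_ne_top μ δ)),
    mul_comm]
  exact measure_slice_jointApproxSet_le μ e hδ z

theorem measure_singleton_eq_zero {ϖ : O} (hϖ : ϖ ≠ 0) (hϖ' : ‖ϖ‖ < 1) (x : O) : μ {x} = 0 := by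
  rw [← scale_zero μ hϖ hϖ', ← measure_closedBall_norm μ x 0]
  simp

theorem ae_ne_zero_and_add_mul_ne_zero {ϖ : O} (hϖ : ϖ ≠ 0) (hϖ' : ‖ϖ‖ < 1) {δ : O}
    (hδ : δ ≠ 0) : ∀ᵐ z ∂(μ.prod μ), z.1 ≠ 0 ∧ z.1 + δ * z.2 ≠ 0 := by
  have h0 := measure_singleton_eq_zero μ hϖ hϖ'
  refine Filter.Eventually.and ?_ ?_
  · have : (μ.prod μ) ({0} ×ˢ univ) = 0 := by rw [Measure.prod_prod, h0, zero_mul]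
    filter_upwards [measure_eq_zero_iff_ae_notMem.1 this] with z hz h
    exact hz ⟨h, mem_univ _⟩
  · have hm : MeasurableSet {z : O × O | z.1 + δ * z.2 = 0} :=
      (isClosed_eq (by fun_prop) continuous_const).measurableSet
    have : (μ.prod μ) {z | z.1 + δ * z.2 = 0} = 0 := by
      rw [Measure.measure_prod_null hm]
      refine ae_of_all _ fun s => ?_
      show μ (Prod.mk s ⁻¹' {z : O × O | z.1 + δ * z.2 = 0}) = 0
      have hsub : (Prod.mk s ⁻¹' {z : O × O | z.1 + δ * z.2 = 0}).Subsingleton := by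
        intro t ht t' ht'
        simp only [mem_preimage, mem_ofPred_eq] at ht ht'
        exact mul_left_cancel₀ hδ (add_left_cancel (ht.trans ht'.symm))
      rcases hsub.eq_empty_or_singleton with h | ⟨t, h⟩
      · rw [h]; simp
      · rw [h]; exact h0 t
    exact measure_eq_zero_iff_ae_notMem.1 this

theorem tendsto_lintegral_slice_jointApproxSet {ϖ : O} (hϖ : ϖ ≠ 0) (hϖ' : ‖ϖ‖ < 1) {δ : O}
    (hδ : δ ≠ 0) :
    Tendsto (fun k : ℕ => (∫⁻ z, (μ.prod μ) (Prod.mk z ⁻¹' jointApproxSet (ϖ ^ k) δ) ∂(μ.prod μ)) /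
      scale μ (ϖ ^ k) ^ 2) atTop (𝓝 (scale μ δ * mixedMoment μ δ)) := by
  have hw (k : ℕ) : scale μ (ϖ ^ k) ^ 2 ≠ 0 := pow_ne_zero _ (scale_pos μ (pow_ne_zero k hϖ)).ne'
  have hw' (k : ℕ) : scale μ (ϖ ^ k) ^ 2 ≠ ∞ := ENNReal.pow_ne_top (scale_ne_top μ _)
  have hms : Measurable fun z : O × O => scale μ z.1 * scale μ (z.1 + δ * z.2) :=
    ((measurable_scale μ).comp measurable_fst).mul
      ((measurable_scale μ).comp (by fun_prop : Continuous fun z : O × O => z.1 + δ * z.2).measurable)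
  have hlim : scale μ δ * mixedMoment μ δ =
      ∫⁻ z, scale μ δ * (scale μ z.1 * scale μ (z.1 + δ * z.2)) ∂(μ.prod μ) := by
    rw [lintegral_const_mul _ hms, lintegral_prod _ hms.aemeasurable, mixedMoment]
  have hmeas (k : ℕ) := measurable_measure_prodMk_left (ν := μ.prod μ)
    (measurableSet_jointApproxSet (ϖ ^ k) δ)
  rw [hlim]
  simp_rw [div_eq_mul_inv]
  conv =>
    enter [1, k]
    rw [← lintegral_mul_const _ (hmeas k)]
  refine tendsto_lintegral_of_dominated_convergence (fun _ => (scale μ δ)⁻¹)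
    (fun k => (hmeas k).mul_const _) (fun k => ae_of_all _ fun z => ?_) ?_ ?_
  · show (μ.prod μ) (Prod.mk z ⁻¹' jointApproxSet (ϖ ^ k) δ) * (scale μ (ϖ ^ k) ^ 2)⁻¹ ≤ _
    rw [← div_eq_mul_inv, ENNReal.div_le_iff (hw k) (hw' k), mul_comm, ← div_eq_mul_inv,
      ENNReal.le_div_iff_mul_le (Or.inl (scale_pos μ hδ).ne') (Or.inl (scale_ne_top μ δ)), mul_comm]
    exact measure_slice_jointApproxSet_le μ _ hδ z
  · simpa using (scale_pos μ hδ).ne'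
  · filter_upwards [ae_ne_zero_and_add_mul_ne_zero μ hϖ hϖ' hδ] with z hz
    refine tendsto_const_nhds.congr' ?_
    have h1 : 0 < ‖δ * (δ * z.1)‖ := norm_pos_iff.2 (mul_ne_zero hδ (mul_ne_zero hδ hz.1))
    have h2 : 0 < ‖δ * (δ * (z.1 + δ * z.2))‖ :=
      norm_pos_iff.2 (mul_ne_zero hδ (mul_ne_zero hδ hz.2))
    filter_upwards [(tendsto_norm_pow_zero hϖ').eventually_lt_const h1,
      (tendsto_norm_pow_zero hϖ').eventually_lt_const h2] with k k1 k2
    rw [measure_slice_jointApproxSet μ (s := z.1) (t := z.2) (pow_ne_zero k hϖ) hδ k1 k2,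
      mul_comm (_ ^ 2), mul_assoc, ENNReal.mul_inv_cancel (hw k) (hw' k), mul_one]

/-- The triples of a polynomial and two approximate roots. -/
def approxRootPairSet (n : ℕ) (e : O) : Set ((Fin (n + 1) → O) × O × O) :=
  {z | (z.1, z.2.1) ∈ approxRootSet n e ∧ (z.1, z.2.2) ∈ approxRootSet n e}

theorem measurableSet_approxRootPairSet (n : ℕ) (e : O) :
    MeasurableSet (approxRootPairSet n e) := by
  have h := measurableSet_approxRootSet (O := O) n e
  exact ((measurable_fst.prodMk measurable_snd.fst) h).inter
    ((measurable_fst.prodMk measurable_snd.snd) h)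

theorem lintegral_ncard_mul_ncard_simpleRoots {e : O} {U V : Set O}
    (hU : ∀ x ∈ U, closedBall x ‖e‖ ⊆ U) (hV : ∀ x ∈ V, closedBall x ‖e‖ ⊆ V) (he : e ≠ 0) :
    ∫⁻ c, ((simpleRoots (coeffPoly n c) e U).ncard : ℝ≥0∞) *
      (simpleRoots (coeffPoly n c) e V).ncard ∂(coeffMeasure μ n) =
    ∫⁻ w, coeffMeasure μ n ((fun c => (c, w)) ⁻¹' approxRootPairSet n e) / scale μ e ^ 2
      ∂((μ.restrict U).prod (μ.restrict V)) := by
  have hm := measurableSet_approxRootPairSet (O := O) n e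
  have hw : scale μ e ^ 2 ≠ 0 := pow_ne_zero _ (scale_pos μ he).ne'
  have hw' : scale μ e ^ 2 ≠ ∞ := ENNReal.pow_ne_top (scale_ne_top μ _)
  have h (c : Fin (n + 1) → O) : ((simpleRoots (coeffPoly n c) e U).ncard : ℝ≥0∞) *
      (simpleRoots (coeffPoly n c) e V).ncard * scale μ e ^ 2 =
      (μ.restrict U).prod (μ.restrict V) (Prod.mk c ⁻¹' approxRootPairSet n e) := by
    have hs : Prod.mk c ⁻¹' approxRootPairSet n e =
        (Prod.mk c ⁻¹' approxRootSet n e) ×ˢ (Prod.mk c ⁻¹' approxRootSet n e) := by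
      ext
      simp [approxRootPairSet]
    rw [hs, Measure.prod_prod, ← ncard_simpleRoots_mul_scale μ c e hU,
      ← ncard_simpleRoots_mul_scale μ c e hV]
    ring
  simp_rw [div_eq_mul_inv]
  rw [lintegral_mul_const' _ _ (ENNReal.inv_ne_top.2 hw), ← div_eq_mul_inv,
    ENNReal.eq_div_iff hw hw', mul_comm, ← lintegral_mul_const' _ _ hw', lintegral_congr h,
    ← Measure.prod_apply hm, Measure.prod_apply_symm hm]

theorem measure_approxRootPairSet (hn : 3 ≤ n) (e : O) (w : O × O) :
    coeffMeasure μ n ((fun c => (c, w)) ⁻¹' approxRootPairSet n e) =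
    ∫⁻ z, (μ.prod μ) (Prod.mk z ⁻¹' jointApproxSet e (w.2 - w.1)) ∂(μ.prod μ) :=
  measure_pair_approxRootSet μ hn e w.1 w.2

theorem IsUniformizer.mixedMoment_congr {ϖ : O} (hϖ : IsUniformizer ϖ) {δ δ' : O} (hδ : δ ≠ 0)
    (h : ‖δ'‖ = ‖δ‖) : mixedMoment μ δ' = mixedMoment μ δ := by
  have hδ' : δ' ≠ 0 := norm_ne_zero_iff.1 (h ▸ norm_ne_zero_iff.2 hδ)
  have hfin (d : O) : mixedMoment μ d ≠ ∞ := ((mixedMoment_le_one μ d).trans_lt one_lt_top).ne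
  rw [← ENNReal.toReal_eq_toReal_iff' (hfin _) (hfin _), hϖ.toReal_mixedMoment μ hδ,
    hϖ.toReal_mixedMoment μ hδ',
    scale.eq_1 μ δ', h, ← scale.eq_1 μ δ]

theorem IsUniformlyOpen.measurableSet {U : Set O} (hU : IsUniformlyOpen U) : MeasurableSet U := by
  obtain ⟨ε, hε, h⟩ := hU
  refine (Metric.isOpen_iff.2 fun x hx => ⟨ε, hε, ?_⟩).measurableSet
  exact ball_subset_closedBall.trans (h x hx)

theorem IsUniformizer.lintegral_ncard_mul_ncard_rootsIn (hn : 3 ≤ n) {ϖ : O}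
    (hϖ : IsUniformizer ϖ) {U V : Set O} (hU : IsUniformlyOpen U) (hV : IsUniformlyOpen V)
    {δ : O} (hδ : δ ≠ 0) (hUV : ∀ x ∈ U, ∀ y ∈ V, ‖y - x‖ = ‖δ‖) :
    ∫⁻ c, ((rootsIn (coeffPoly n c) U).ncard : ℝ≥0∞) * (rootsIn (coeffPoly n c) V).ncard
      ∂(coeffMeasure μ n) = μ U * μ V * (scale μ δ * mixedMoment μ δ) := by
  have hϖ0 := hϖ.ne_zero
  have hϖ1 := hϖ.norm_lt_one
  obtain ⟨K, hK⟩ := eventually_atTop.1 ((hU.eventually hϖ1).and (hV.eventually hϖ1))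
  have hKU (k : ℕ) := (hK (k + K) (by omega)).1
  have hKV (k : ℕ) := (hK (k + K) (by omega)).2
  have hpow (k : ℕ) : ϖ ^ (k + K) ≠ 0 := pow_ne_zero _ hϖ0
  have hlim : Tendsto (fun k : ℕ => ∫⁻ c,
      ((simpleRoots (coeffPoly n c) (ϖ ^ (k + K)) U).ncard : ℝ≥0∞) *
        (simpleRoots (coeffPoly n c) (ϖ ^ (k + K)) V).ncard ∂(coeffMeasure μ n)) atTop
      (𝓝 (∫⁻ c, ((rootsIn (coeffPoly n c) U).ncard : ℝ≥0∞) *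
        (rootsIn (coeffPoly n c) V).ncard ∂(coeffMeasure μ n))) := by
    refine tendsto_lintegral_of_dominated_convergence (fun _ => (n : ℝ≥0∞) * n)
      (fun k => (measurable_ncard_simpleRoots μ n (hpow k) (hKU k)).mul
        (measurable_ncard_simpleRoots μ n (hpow k) (hKV k)))
      (fun k => ae_of_all _ fun c => ?_) ?_ ?_
    · exact mul_le_mul' (Nat.cast_le.2 ((ncard_simpleRoots_le _ _ _).trans
        (natDegree_coeffPoly_le c))) (Nat.cast_le.2 ((ncard_simpleRoots_le _ _ _).trans
        (natDegree_coeffPoly_le c)))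
    · simpa using ENNReal.mul_ne_top (natCast_ne_top n) (natCast_ne_top n)
    · filter_upwards [ae_eventually_simpleRoots_eq μ (by omega) hϖ0 hϖ1] with c hc
      refine tendsto_const_nhds.congr' ?_
      filter_upwards [(tendsto_add_atTop_nat K).eventually hc.2] with k hk
      rw [hk, hk]
  simp_rw [fun k => lintegral_ncard_mul_ncard_simpleRoots μ (n := n) (hKU k) (hKV k) (hpow k)]
    at hlim
  refine tendsto_nhds_unique hlim ?_
  have hconst : μ U * μ V * (scale μ δ * mixedMoment μ δ) =
      ∫⁻ _, scale μ δ * mixedMoment μ δ ∂((μ.restrict U).prod (μ.restrict V)) := by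
    rw [lintegral_const, ← univ_prod_univ, Measure.prod_prod, Measure.restrict_apply_univ,
      Measure.restrict_apply_univ, mul_comm]
  have hmem : ∀ᵐ w ∂((μ.restrict U).prod (μ.restrict V)), ‖w.2 - w.1‖ = ‖δ‖ := by
    rw [Measure.prod_restrict]
    filter_upwards [ae_restrict_mem (hU.measurableSet.prod hV.measurableSet)] with w hw
    exact hUV _ hw.1 _ hw.2
  have hne {w : O × O} (hw : ‖w.2 - w.1‖ = ‖δ‖) : w.2 - w.1 ≠ 0 :=
    norm_ne_zero_iff.1 (hw ▸ norm_ne_zero_iff.2 hδ)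
  have hsc {w : O × O} (hw : ‖w.2 - w.1‖ = ‖δ‖) : scale μ (w.2 - w.1) = scale μ δ := by
    rw [scale, hw, ← scale.eq_1]
  rw [hconst]
  refine tendsto_lintegral_of_dominated_convergence (fun _ => (scale μ δ)⁻¹)
    (fun k => (measurable_measure_prodMk_right
      (measurableSet_approxRootPairSet n _)).div_const _) (fun k => ?_) ?_ ?_
  · filter_upwards [hmem] with w hw
    rw [measure_approxRootPairSet μ hn]
    refine ENNReal.div_le_of_le_mul ((lintegral_slice_jointApproxSet_le μ _ (hne hw)).trans ?_)
    rw [hsc hw, div_eq_mul_inv, mul_comm]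
  · rw [lintegral_const]
    exact ENNReal.mul_ne_top (ENNReal.inv_ne_top.2 (scale_pos μ hδ).ne') (measure_ne_top _ _)
  · filter_upwards [hmem] with w hw
    simp_rw [measure_approxRootPairSet μ hn]
    rw [← hsc hw, ← hϖ.mixedMoment_congr μ hδ hw]
    exact (tendsto_lintegral_slice_jointApproxSet μ hϖ0 hϖ1 (hne hw)).comp
      (tendsto_add_atTop_nat K)

end SecondMoment

section ResidueField

variable {O : Type*} [NormedCommRing O] [NormOneClass O] [NormMulClass O] [IsUltrametricDist O]
  [CompactSpace O] [SecondCountableTopology O] [IsNormValuationRing O]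

theorem exists_isUniformizer {x : O} (hx : x ≠ 0) (hx' : ‖x‖ < 1) : ∃ ϖ : O, IsUniformizer ϖ := by
  obtain ⟨ϖ, h, hmax⟩ := (IsUltrametricDist.isClosed_ball (0 : O) 1).isCompact.exists_isMaxOn
    ⟨x, by simpa using hx'⟩ (f := fun y => ‖y‖) (by fun_prop)
  refine ⟨ϖ, ?_, by simpa using h, fun y hy => hmax (by simpa using hy)⟩
  rintro rfl
  have : ‖x‖ ≤ ‖(0 : O)‖ := hmax (a := x) (by simpa using hx')
  exact hx (norm_le_zero_iff.1 (this.trans norm_zero.le))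

theorem isUnit_iff_norm_eq_one {x : O} : IsUnit x ↔ ‖x‖ = 1 := by
  rw [isUnit_iff_dvd_one, ← norm_le_iff_dvd, norm_one]
  exact ⟨fun h => le_antisymm (norm_le_one x) h, fun h => h.ge⟩

variable [MeasurableSpace O] [BorelSpace O] (μ : Measure O) [IsProbabilityMeasure μ]
  [μ.IsAddHaarMeasure]

theorem IsUniformizer.card_residueField_mul_scale [IsLocalRing O] {ϖ : O} (hϖ : IsUniformizer ϖ) :
    (Nat.card (IsLocalRing.ResidueField O) : ℝ≥0∞) * scale μ ϖ = 1 := by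
  set H := (IsLocalRing.maximalIdeal O).toAddSubgroup with hH
  have hset : (H : Set O) = closedBall 0 ‖ϖ‖ := by
    ext x
    rw [← not_iff_not]
    refine Iff.trans ?_ (hϖ.norm_eq_one_iff x).symm
    rw [← isUnit_iff_norm_eq_one]
    exact IsLocalRing.notMem_maximalIdeal
  have hopen : IsOpen (H : Set O) := by
    rw [hset]
    exact IsUltrametricDist.isOpen_closedBall _ (norm_ne_zero_iff.2 hϖ.ne_zero)
  have : Finite (O ⧸ H) := H.quotient_finite_of_isOpen hopen
  have : H.FiniteIndex := H.finiteIndex_of_finite_quotient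
  have h := H.index_mul_measure hopen.measurableSet μ
  rw [measure_univ, hset] at h
  exact h

end ResidueField

section PadicIntegers

variable (p : ℕ) [Fact p.Prime]

instance isNormValuationRing_padicInt : IsNormValuationRing ℤ_[p] where
  norm_le_one := PadicInt.norm_le_one
  dvd_of_norm_le {a b} h := by
    by_cases hb : b = 0
    · subst hb
      rw [norm_zero, norm_le_zero_iff] at h
      rw [h]
    · have hb' : (b : ℚ_[p]) ≠ 0 := by simpa using hb
      have hq : ‖(a / b : ℚ_[p])‖ ≤ 1 := by
        rw [norm_div]
        exact div_le_one_of_le₀ h (norm_nonneg _)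
      refine ⟨⟨a / b, hq⟩, ?_⟩
      exact Subtype.ext (mul_div_cancel₀ (a : ℚ_[p]) hb').symm

theorem isUniformizer_padicInt : IsUniformizer (p : ℤ_[p]) where
  ne_zero := by exact_mod_cast (Fact.out : p.Prime).ne_zero
  norm_lt_one := by
    rw [PadicInt.norm_p]
    exact inv_lt_one_of_one_lt₀ (by exact_mod_cast (Fact.out : p.Prime).one_lt)
  norm_le x hx := by
    rw [norm_le_iff_dvd]
    exact PadicInt.norm_lt_one_iff_dvd x |>.1 hx

variable {O : Type*} [NormedCommRing O] [NormOneClass O] [NormMulClass O] [IsUltrametricDist O]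
  [CompactSpace O] [SecondCountableTopology O] [IsNormValuationRing O]
  [MeasurableSpace O] [BorelSpace O] (μ : Measure O) [IsProbabilityMeasure μ]
  [μ.IsAddHaarMeasure]

theorem scale_natCast_prime {d : ℕ} (ι : (Fin d → ℤ_[p]) →+ O) (hι : IsOpenEmbedding ι)
    (hp : (p : O) ≠ 0) : scale μ (p : O) = ((p : ℝ≥0∞)⁻¹) ^ d := by
  let _ : MeasurableSpace ℤ_[p] := borel _
  have : BorelSpace ℤ_[p] := ⟨rfl⟩
  let ν : Measure ℤ_[p] := Measure.addHaarMeasure ⊤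
  have : IsProbabilityMeasure ν := ⟨Measure.addHaarMeasure_self⟩
  have hν : scale ν (p : ℤ_[p]) = (p : ℝ≥0∞)⁻¹ := by
    have h := (isUniformizer_padicInt p).card_residueField_mul_scale ν
    rw [Nat.card_congr PadicInt.residueField.toEquiv, Nat.card_zmod] at h
    exact ENNReal.eq_inv_of_mul_eq_one_left (by rwa [mul_comm])
  have : (μ.comap ι).IsAddHaarMeasure :=
    Measure.IsAddHaarMeasure.comap (mH := inferInstance) μ hι
  have hκ := Measure.isAddLeftInvariant_eq_smul (μ.comap ι) (Measure.pi fun _ : Fin d => ν)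
  set κ := (μ.comap ι).addHaarScalarFactor (Measure.pi fun _ : Fin d => ν)
  have hκ0 : μ (range ι) = κ := by
    have := congrArg (fun m => m univ) hκ
    rw [hι.measurableEmbedding.comap_apply, image_univ, Measure.smul_apply, measure_univ] at this
    rw [this, ENNReal.smul_def, smul_eq_mul, mul_one]
  have hpos : μ (range ι) ≠ 0 := (hι.isOpen_range.measure_pos μ (range_nonempty ι)).ne'
  have hball : ι '' (univ.pi fun _ => closedBall 0 ‖(p : ℤ_[p])‖) =
      (fun x => (p : O) * x) '' range ι := by
    ext x
    constructor
    · rintro ⟨v, hv, rfl⟩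
      have hdvd (i : Fin d) : (p : ℤ_[p]) ∣ v i := by
        rw [← norm_le_iff_dvd]
        simpa using hv i (mem_univ i)
      choose w hw using hdvd
      refine ⟨ι w, mem_range_self w, ?_⟩
      simp only [← nsmul_eq_mul, ← map_nsmul]
      congr 1
      ext i
      simp [hw i]
    · rintro ⟨_, ⟨w, rfl⟩, rfl⟩
      refine ⟨p • w, fun i _ => ?_, by rw [map_nsmul, nsmul_eq_mul]⟩
      rw [mem_closedBall, dist_zero_right, norm_le_iff_dvd]
      exact ⟨w i, by simp⟩
  have h1 := congrArg (fun m => m (univ.pi fun _ => closedBall 0 ‖(p : ℤ_[p])‖)) hκ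
  have h2 := congrArg (fun m => m (range ι)) (comap_mul_left μ hp)
  simp only [(isClosedEmbedding_mul_left hp).measurableEmbedding.comap_apply,
    Measure.smul_apply, smul_eq_mul] at h2
  simp only [hι.measurableEmbedding.comap_apply, hball, h2, Measure.smul_apply, Measure.pi_pi,
    Finset.prod_const, Finset.card_univ, Fintype.card_fin, ENNReal.smul_def, smul_eq_mul,
    ← hκ0] at h1
  rw [← scale, hν, mul_comm] at h1
  exact (ENNReal.mul_right_inj hpos (measure_ne_top _ _)).1 h1

theorem toReal_scale_eq_norm_pow {d : ℕ} (ι : (Fin d → ℤ_[p]) →+ O) (hι : IsOpenEmbedding ι)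
    (hp : ‖(p : O)‖ = (p : ℝ)⁻¹) {c : O} (hc : c ≠ 0) :
    (scale μ c).toReal = ‖c‖ ^ d := by
  have hprime : p.Prime := Fact.out
  have hp1 : ‖(p : O)‖ < 1 := by
    rw [hp]
    exact inv_lt_one_of_one_lt₀ (by exact_mod_cast hprime.one_lt)
  have hp0 : (p : O) ≠ 0 := by
    rw [← norm_ne_zero_iff, hp]
    exact inv_ne_zero (by exact_mod_cast hprime.ne_zero)
  obtain ⟨ϖ, hϖ⟩ := exists_isUniformizer hp0 hp1
  have key : (scale μ ϖ).toReal = ‖ϖ‖ ^ d := by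
    obtain ⟨k, u, hk, hu⟩ := hϖ.exists_eq_pow_mul hp0
    have hk0 : k ≠ 0 := by
      rintro rfl
      rw [hk, pow_zero, one_mul, hu] at hp1
      exact lt_irrefl _ hp1
    have h := congrArg ENNReal.toReal (scale_natCast_prime p μ ι hι hp0)
    rw [toReal_pow, toReal_inv, toReal_natCast, ← hp, hk, scale_mul μ _ _ (pow_ne_zero k hϖ.ne_zero),
      scale_of_norm_eq_one μ hu, mul_one, scale_pow μ hϖ.ne_zero, toReal_pow, norm_mul, hu, mul_one,
      norm_pow, ← pow_mul, mul_comm, pow_mul] at h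
    exact (pow_left_inj₀ toReal_nonneg (by positivity) hk0).1 h
  obtain ⟨k, u, rfl, hu⟩ := hϖ.exists_eq_pow_mul hc
  rw [scale_mul μ _ _ (pow_ne_zero k hϖ.ne_zero), scale_of_norm_eq_one μ hu, mul_one,
    scale_pow μ hϖ.ne_zero, toReal_pow, key, norm_mul, hu, mul_one, norm_pow, ← pow_mul, ← pow_mul,
    mul_comm]

end PadicIntegers

section Integers

variable (p : ℕ) [Fact p.Prime] (F : Type*) [NormedField F] [NormedAlgebra ℚ_[p] F]

instance isUltrametricDist_integers : IsUltrametricDist (integers p F) :=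
  IsUltrametricDist.isUltrametricDist_of_forall_norm_add_le_max_norm fun x y =>
    norm_add_le_max p F x y

instance isNormValuationRing_integers : IsNormValuationRing (integers p F) where
  norm_le_one x := x.2
  dvd_of_norm_le {a b} h := by
    by_cases hb : b = 0
    · subst hb
      rw [norm_zero, norm_le_zero_iff] at h
      rw [h]
    · have hb' : (b : F) ≠ 0 := by simpa using hb
      have hq : ‖(a / b : F)‖ ≤ 1 := by
        rw [norm_div]
        exact div_le_one_of_le₀ h (norm_nonneg _)
      refine ⟨⟨a / b, hq⟩, ?_⟩
      apply Subtype.ext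
      exact (mul_div_cancel₀ _ hb').symm

theorem norm_natCast_prime_field : ‖(p : F)‖ = (p : ℝ)⁻¹ := by
  rw [← map_natCast (algebraMap ℚ_[p] F), norm_algebraMap', Padic.norm_p]

theorem coe_integers_eq : (integers p F : Set F) = closedBall 0 1 := by
  ext x
  rw [mem_closedBall, dist_zero_right]
  rfl

theorem isOpen_integers : IsOpen (integers p F : Set F) := by
  have : IsUltrametricDist F := IsUltrametricDist.of_normedAlgebra ℚ_[p]
  rw [coe_integers_eq]
  exact IsUltrametricDist.isOpen_closedBall _ one_ne_zero

variable [FiniteDimensional ℚ_[p] F]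

instance compactSpace_integers : CompactSpace (integers p F) := by
  have := FiniteDimensional.proper ℚ_[p] F
  have h : IsCompact (integers p F : Set F) := by
    rw [coe_integers_eq]
    exact isCompact_closedBall 0 1
  exact isCompact_iff_compactSpace.1 h

theorem exists_lattice : ∃ ι : (Fin (Module.finrank ℚ_[p] F) → ℤ_[p]) →+ integers p F,
    IsOpenEmbedding ι := by
  set d := Module.finrank ℚ_[p] F
  let e : (Fin d → ℚ_[p]) ≃L[ℚ_[p]] F :=
    (Module.finBasis ℚ_[p] F).equivFun.symm.toContinuousLinearEquiv
  let j : (Fin d → ℤ_[p]) →+ F :=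
    { toFun := fun v => e fun i => (v i : ℚ_[p])
      map_zero' := by
        rw [← map_zero e]
        rfl
      map_add' := fun v w => by
        rw [← map_add]
        rfl }
  have hjc : Continuous j := e.continuous.comp
    (continuous_pi fun i => continuous_subtype_val.comp (continuous_apply i))
  have hji : Function.Injective j := fun v w h => by
    have := e.injective h
    exact funext fun i => Subtype.ext (congrFun this i)
  have hrange : range j = e '' univ.pi fun _ => closedBall 0 1 := by
    ext x
    constructor
    · rintro ⟨v, rfl⟩
      exact ⟨_, fun i _ => by simpa using PadicInt.norm_le_one (v i), rfl⟩
    · rintro ⟨w, hw, rfl⟩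
      refine ⟨fun i => ⟨w i, by simpa using hw i (mem_univ i)⟩, rfl⟩
  have hopen : IsOpen (range j) := by
    rw [hrange]
    exact e.toHomeomorph.isOpenMap _ (isOpen_set_pi finite_univ fun _ _ =>
      IsUltrametricDist.isOpen_closedBall _ one_ne_zero)
  obtain ⟨B, hB⟩ := (isCompact_range hjc).isBounded.exists_norm_le
  have hp0 : ‖(p : F)‖ ≠ 0 := by
    rw [norm_natCast_prime_field p F]
    exact inv_ne_zero (by exact_mod_cast (Fact.out : p.Prime).ne_zero)
  obtain ⟨N, hN⟩ : ∃ N : ℕ, ‖(p : F)‖ ^ N * |B| ≤ 1 := by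
    have hlim : Tendsto (fun N : ℕ => ‖(p : F)‖ ^ N * |B|) atTop (𝓝 (0 * |B|)) := by
      refine (_root_.tendsto_pow_atTop_nhds_zero_of_lt_one (norm_nonneg _) ?_).mul_const _
      rw [norm_natCast_prime_field p F]
      exact inv_lt_one_of_one_lt₀ (by exact_mod_cast (Fact.out : p.Prime).one_lt)
    rw [zero_mul] at hlim
    exact (hlim.eventually_le_const one_pos).exists
  have hc0 : (p : F) ^ N ≠ 0 := pow_ne_zero N (norm_ne_zero_iff.1 hp0)
  have hmem (v) : ‖(p : F) ^ N * j v‖ ≤ 1 := by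
    rw [norm_mul, norm_pow]
    refine le_trans ?_ hN
    gcongr
    exact (hB _ (mem_range_self v)).trans (le_abs_self B)
  let ι : (Fin d → ℤ_[p]) →+ integers p F :=
    { toFun := fun v => ⟨(p : F) ^ N * j v, hmem v⟩
      map_zero' := Subtype.ext (by simp)
      map_add' := fun v w => Subtype.ext (by simp [mul_add]) }
  have hιc : Continuous ι := (continuous_const.mul hjc).subtype_mk _
  have hιi : Function.Injective ι := fun v w h =>
    hji (mul_left_cancel₀ hc0 (congrArg Subtype.val h))
  refine ⟨ι, ⟨(hιc.isClosedEmbedding hιi).isEmbedding, ?_⟩⟩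
  have : range ι = Subtype.val ⁻¹' ((fun x => (p : F) ^ N * x) '' range j) := by
    ext x
    constructor
    · rintro ⟨v, rfl⟩
      exact ⟨j v, mem_range_self v, rfl⟩
    · rintro ⟨_, ⟨v, rfl⟩, hv⟩
      exact ⟨v, Subtype.ext hv⟩
  rw [this]
  exact ((Homeomorph.mulLeft₀ _ hc0).isOpenMap _ hopen).preimage continuous_subtype_val

variable [MeasurableSpace F] [BorelSpace F]

/-- The Haar probability measure of the ring of integers. -/
noncomputable abbrev integersMeasure : Measure (integers p F) :=
  (haarMeasure p F).comap Subtype.val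

instance isProbabilityMeasure_integersMeasure : IsProbabilityMeasure (integersMeasure p F) := by
  constructor
  have he : MeasurableEmbedding (Subtype.val : integers p F → F) :=
    .subtype_coe (isOpen_integers p F).measurableSet
  have h : range (Subtype.val : integers p F → F) = (unitBall p F : Set F) :=
    Subtype.range_val.trans (coe_integers_eq p F)
  rw [integersMeasure, he.comap_apply, image_univ, h]
  exact Measure.addHaarMeasure_self

instance isAddHaarMeasure_integersMeasure : (integersMeasure p F).IsAddHaarMeasure := by
  have : (haarMeasure p F).IsAddHaarMeasure := by
    unfold haarMeasure
    infer_instance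
  exact Measure.IsAddHaarMeasure.comap (mH := inferInstance) (haarMeasure p F)
    (f := (integers p F).subtype.toAddMonoidHom) (isOpen_integers p F).isOpenEmbedding_subtypeVal

theorem toReal_scale_integersMeasure {c : integers p F} (hc : c ≠ 0) :
    (scale (integersMeasure p F) c).toReal = normalizedNorm p (c : F) := by
  obtain ⟨ι, hι⟩ := exists_lattice p F
  refine toReal_scale_eq_norm_pow p _ ι hι ?_ hc
  rw [← norm_natCast_prime_field p F]
  rfl

end Integers

section RealMoments

variable {O : Type*} [NormedCommRing O] [NormOneClass O] [NormMulClass O] [IsUltrametricDist O]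
  [CompactSpace O] [SecondCountableTopology O] [IsNormValuationRing O]
  [MeasurableSpace O] [BorelSpace O] (μ : Measure O) [IsProbabilityMeasure μ]
  [μ.IsAddHaarMeasure] {n : ℕ}

theorem aemeasurable_ncard_rootsIn (hn : 1 ≤ n) {ϖ : O} (hϖ : IsUniformizer ϖ) {U : Set O}
    (hU : IsUniformlyOpen U) :
    AEMeasurable (fun c => ((rootsIn (coeffPoly n c) U).ncard : ℝ≥0∞)) (coeffMeasure μ n) := by
  obtain ⟨K, hK⟩ := eventually_atTop.1 (hU.eventually hϖ.norm_lt_one)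
  refine aemeasurable_of_tendsto_metrizable_ae' (fun k : ℕ => (measurable_ncard_simpleRoots μ n
    (pow_ne_zero (k + K) hϖ.ne_zero) (hK (k + K) (by omega))).aemeasurable) ?_
  filter_upwards [ae_eventually_simpleRoots_eq μ hn hϖ.ne_zero hϖ.norm_lt_one] with c hc
  refine tendsto_const_nhds.congr' ?_
  filter_upwards [(tendsto_add_atTop_nat K).eventually hc.2] with k hk
  rw [hk]

theorem memLp_ncard_rootsIn (hn : 1 ≤ n) {ϖ : O} (hϖ : IsUniformizer ϖ) {U : Set O}
    (hU : IsUniformlyOpen U) (r : ℝ≥0∞) :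
    MemLp (fun c => ((rootsIn (coeffPoly n c) U).ncard : ℝ)) r (coeffMeasure μ n) := by
  have hm := (aemeasurable_ncard_rootsIn μ hn hϖ hU).ennreal_toReal
  simp only [toReal_natCast] at hm
  refine MemLp.of_bound hm.aestronglyMeasurable n ?_
  filter_upwards [ae_eventually_simpleRoots_eq μ hn hϖ.ne_zero hϖ.norm_lt_one] with c hc
  rw [Real.norm_natCast]
  exact Nat.cast_le.2 (ncard_rootsIn_le hc.1 U)

theorem integral_ncard_rootsIn (hn : 1 ≤ n) {ϖ : O} (hϖ : IsUniformizer ϖ) {U : Set O}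
    (hU : IsUniformlyOpen U) :
    ∫ c, ((rootsIn (coeffPoly n c) U).ncard : ℝ) ∂(coeffMeasure μ n) =
      μ.real U * (meanScale μ).toReal := by
  have h := integral_toReal (aemeasurable_ncard_rootsIn μ hn hϖ hU)
    (ae_of_all _ fun c => natCast_lt_top _)
  simp only [toReal_natCast] at h
  rw [h, lintegral_ncard_rootsIn μ hn hϖ.ne_zero hϖ.norm_lt_one hU, toReal_mul, measureReal_def]

theorem integral_ncard_mul_ncard_rootsIn (hn : 3 ≤ n) {ϖ : O} (hϖ : IsUniformizer ϖ) {U V : Set O}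
    (hU : IsUniformlyOpen U) (hV : IsUniformlyOpen V) {δ : O} (hδ : δ ≠ 0)
    (hUV : ∀ x ∈ U, ∀ y ∈ V, ‖y - x‖ = ‖δ‖) :
    ∫ c, ((rootsIn (coeffPoly n c) U).ncard : ℝ) * (rootsIn (coeffPoly n c) V).ncard
      ∂(coeffMeasure μ n) =
      μ.real U * μ.real V * ((scale μ δ).toReal * (mixedMoment μ δ).toReal) := by
  have h := integral_toReal ((aemeasurable_ncard_rootsIn μ (n := n) (by omega) hϖ hU).mul
    (aemeasurable_ncard_rootsIn μ (by omega) hϖ hV))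
    (ae_of_all _ fun c => mul_lt_top (natCast_lt_top _) (natCast_lt_top _))
  simp only [Pi.mul_apply, toReal_mul, toReal_natCast] at h
  rw [h, hϖ.lintegral_ncard_mul_ncard_rootsIn μ hn hU hV hδ hUV, toReal_mul, toReal_mul, toReal_mul,
    measureReal_def, measureReal_def]

end RealMoments

section Balls

variable {F : Type*} [NormedField F] [IsUltrametricDist F]

theorem IsBall.dist_lt {U : Set F} (hU : IsBall U) {x y z : F} (hx : x ∈ U) (hy : y ∈ U)
    (hz : z ∉ U) : dist x y < dist z x := by
  obtain ⟨a, r, -, rfl | rfl⟩ := hU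
  · rw [IsUltrametricDist.ball_eq_of_mem hx] at hy hz
    rw [mem_ball] at hy hz
    rw [dist_comm x y]
    exact hy.trans_le (not_lt.1 hz)
  · rw [IsUltrametricDist.closedBall_eq_of_mem hx] at hy hz
    rw [mem_closedBall] at hy hz
    rw [dist_comm x y]
    exact hy.trans_lt (not_le.1 hz)

theorem IsBall.norm_sub_eq {U : Set F} (hU : IsBall U) {x y z : F} (hx : x ∈ U) (hy : y ∈ U)
    (hz : z ∉ U) : ‖z - y‖ = ‖z - x‖ := by
  have h := hU.dist_lt hx hy hz
  rw [dist_eq_norm, dist_eq_norm] at h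
  have h2 := IsUltrametricDist.norm_add_eq_max_of_norm_ne_norm h.ne'
  rwa [sub_add_sub_cancel, max_eq_left h.le] at h2

theorem IsBall.exists_closedBall_subset {U : Set F} (hU : IsBall U) :
    ∃ ε > 0, ∀ x ∈ U, closedBall x ε ⊆ U := by
  obtain ⟨a, r, hr, rfl | rfl⟩ := hU
  · refine ⟨r / 2, by positivity, fun x hx => ?_⟩
    rw [IsUltrametricDist.ball_eq_of_mem hx]
    exact closedBall_subset_ball (by linarith)
  · refine ⟨r, hr, fun x hx => ?_⟩
    rw [IsUltrametricDist.closedBall_eq_of_mem hx]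

end Balls

section Transfer

variable {p : ℕ} [Fact p.Prime] {F : Type*} [NormedField F] [NormedAlgebra ℚ_[p] F] {n : ℕ}

theorem toPoly_eq_map (c : Fin (n + 1) → integers p F) :
    toPoly c = (coeffPoly n c).map (integers p F).subtype := by
  rw [toPoly, coeffPoly_apply, Polynomial.map_sum]
  simp [C_mul_X_pow_eq_monomial]

theorem rootCount_eq_encard {U : Set F} (hU : U ⊆ (integers p F : Set F))
    (c : Fin (n + 1) → integers p F) :
    rootCount U c = (rootsIn (coeffPoly n c) (Subtype.val ⁻¹' U)).encard := by
  rw [rootCount, ← Subtype.val_injective.encard_image]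
  congr 1
  have heval (x : integers p F) : (toPoly c).eval (x : F) =
        (((coeffPoly n c).eval x : integers p F) : F) := by
    rw [toPoly_eq_map]
    exact eval_map_apply (f := (integers p F).subtype) x
  ext x
  constructor
  · rintro ⟨hx, h0⟩
    refine ⟨⟨x, hU hx⟩, ⟨hx, ?_⟩, rfl⟩
    apply Subtype.ext
    rw [← heval]
    exact h0
  · rintro ⟨y, ⟨hy, h0⟩, rfl⟩
    refine ⟨hy, ?_⟩
    rw [IsRoot, heval, h0]
    rfl

theorem Z_eq_ncard {U : Set F} (hU : U ⊆ (integers p F : Set F)) :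
    Z p U n = fun c => ((rootsIn (coeffPoly n c) (Subtype.val ⁻¹' U)).ncard : ℝ) := by
  ext c
  rw [Z, rootCount_eq_encard hU, ncard]

theorem IsBall.isUniformlyOpen {U : Set F} (hU : IsBall U) :
    IsUniformlyOpen (Subtype.val ⁻¹' U : Set (integers p F)) := by
  have : IsUltrametricDist F := IsUltrametricDist.of_normedAlgebra ℚ_[p]
  obtain ⟨ε, hε, h⟩ := hU.exists_closedBall_subset
  exact ⟨ε, hε, fun x hx y hy => h x hx hy⟩

end Transfer

/-- The closed form of the covariance ratio in `[0, 1]` is nonpositive and vanishes only at `1`. -/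
theorem covariance_ratio_nonpos {q d : ℝ} (hq : 2 ≤ q) (hd : 0 ≤ d) (hd1 : d ≤ 1) :
    -1 + (q + 1) ^ 2 / (q ^ 2 + q + 1) * d - q / (q ^ 2 + q + 1) * d ^ 4 ≤ 0 ∧
      (-1 + (q + 1) ^ 2 / (q ^ 2 + q + 1) * d - q / (q ^ 2 + q + 1) * d ^ 4 = 0 ↔ d = 1) := by
  have hS : 0 < q ^ 2 + q + 1 := by positivity
  have hfac : -1 + (q + 1) ^ 2 / (q ^ 2 + q + 1) * d - q / (q ^ 2 + q + 1) * d ^ 4 =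
      -((1 - d) * ((q + 1) ^ 2 - q * (1 + d + d ^ 2 + d ^ 3)) / (q ^ 2 + q + 1)) := by
    field_simp
    ring
  have hpos : 0 < (q + 1) ^ 2 - q * (1 + d + d ^ 2 + d ^ 3) := by
    have h2 : d ^ 2 ≤ 1 := pow_le_one₀ hd hd1
    have h3 : d ^ 3 ≤ 1 := pow_le_one₀ hd hd1
    nlinarith
  rw [hfac]
  refine ⟨neg_nonpos.2 (div_nonneg (mul_nonneg (by linarith) hpos.le) hS.le), ?_⟩
  rw [neg_eq_zero, _root_.div_eq_zero_iff, or_iff_left hS.ne', mul_eq_zero, or_iff_left hpos.ne']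
  exact ⟨fun h => by linarith, fun h => by linarith⟩

end PadicRoots

theorem theoremF (p : ℕ) [Fact p.Prime] (F : Type*) [NormedField F] [NormedAlgebra ℚ_[p] F]
    [FiniteDimensional ℚ_[p] F] [MeasurableSpace F] [BorelSpace F]
    (q : ℝ) (hq : q = PadicRoots.residueCard p F)
    (U V : Set F) (hU : PadicRoots.IsBall U) (hV : PadicRoots.IsBall V)
    (hUO : U ⊆ (PadicRoots.integers p F : Set F)) (hVO : V ⊆ (PadicRoots.integers p F : Set F))
    (hUV : Disjoint U V) (u v : F) (hu : u ∈ U) (hv : v ∈ V) (n : ℕ) (hn : 3 ≤ n) :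
    IsProbabilityMeasure (PadicRoots.polyMeasure p F n) ∧
    (∀ᵐ c ∂(PadicRoots.polyMeasure p F n),
      PadicRoots.rootCount U c ≠ ⊤ ∧ PadicRoots.rootCount V c ≠ ⊤) ∧
    MemLp (PadicRoots.Z p U n) 2 (PadicRoots.polyMeasure p F n) ∧
    MemLp (PadicRoots.Z p V n) 2 (PadicRoots.polyMeasure p F n) ∧
    0 < ∫ c, PadicRoots.Z p U n c ∂(PadicRoots.polyMeasure p F n) ∧
    0 < ∫ c, PadicRoots.Z p V n c ∂(PadicRoots.polyMeasure p F n) ∧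
    cov[PadicRoots.Z p U n, PadicRoots.Z p V n; PadicRoots.polyMeasure p F n] /
        ((∫ c, PadicRoots.Z p U n c ∂(PadicRoots.polyMeasure p F n)) *
          ∫ c, PadicRoots.Z p V n c ∂(PadicRoots.polyMeasure p F n)) =
      -1 + (q + 1) ^ 2 / (q ^ 2 + q + 1) * PadicRoots.normalizedNorm p (u - v)
        - q / (q ^ 2 + q + 1) * PadicRoots.normalizedNorm p (u - v) ^ 4 ∧
    cov[PadicRoots.Z p U n, PadicRoots.Z p V n; PadicRoots.polyMeasure p F n] ≤ 0 ∧
    (cov[PadicRoots.Z p U n, PadicRoots.Z p V n; PadicRoots.polyMeasure p F n] = 0 ↔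
      PadicRoots.normalizedNorm p (u - v) = 1) := by
  open PadicRoots in
  have : IsUltrametricDist F := IsUltrametricDist.of_normedAlgebra ℚ_[p]
  set μ := integersMeasure p F
  have hpoly : polyMeasure p F n = coeffMeasure μ n := rfl
  have hprob : IsProbabilityMeasure (polyMeasure p F n) := by
    rw [hpoly]
    infer_instance
  have hcard := fun ϖ (hϖ : IsUniformizer (O := integers p F) ϖ) =>
    hϖ.card_residueField_mul_scale μ
  obtain ⟨ϖ, hϖ⟩ : ∃ ϖ : integers p F, IsUniformizer ϖ := by
    have hp := norm_natCast_prime_field p F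
    have h1 : (1 : ℝ) < p := by exact_mod_cast (Fact.out : p.Prime).one_lt
    have hnorm : ‖(p : integers p F)‖ = (p : ℝ)⁻¹ := hp
    refine exists_isUniformizer (x := (p : integers p F)) ?_ ?_
    · rw [← norm_ne_zero_iff, hnorm]
      positivity
    · rw [hnorm]
      exact inv_lt_one_of_one_lt₀ h1
  specialize hcard ϖ hϖ
  have hqw : q * (scale μ ϖ).toReal = 1 := by
    have := congrArg ENNReal.toReal hcard
    rwa [ENNReal.toReal_mul, ENNReal.toReal_natCast, ENNReal.toReal_one,
      show (Nat.card (IsLocalRing.ResidueField (integers p F)) : ℝ) = q from hq.symm] at this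
  have hw2 : (scale μ ϖ).toReal ≤ 2⁻¹ := by
    have := ENNReal.toReal_mono (by simp) (scale_le_half μ hϖ.norm_lt_one)
    rwa [ENNReal.toReal_inv, ENNReal.toReal_ofNat] at this
  have hw0 : 0 < (scale μ ϖ).toReal :=
    ENNReal.toReal_pos (scale_pos μ hϖ.ne_zero).ne' (scale_ne_top μ ϖ)
  have hq2 : 2 ≤ q := by
    by_contra h
    nlinarith
  have hwq : (scale μ ϖ).toReal = 1 / q := by
    field_simp
    linarith
  set U' : Set (integers p F) := Subtype.val ⁻¹' U
  set V' : Set (integers p F) := Subtype.val ⁻¹' V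
  have hUo : IsUniformlyOpen U' := hU.isUniformlyOpen
  have hVo : IsUniformlyOpen V' := hV.isUniformlyOpen
  have hposU : 0 < μ.real U' := by
    obtain ⟨ε, hε, h⟩ := hUo
    refine ENNReal.toReal_pos ?_ (measure_ne_top _ _)
    exact ((Metric.measure_closedBall_pos μ _ hε).trans_le
      (measure_mono (h ⟨u, hUO hu⟩ hu))).ne'
  have hposV : 0 < μ.real V' := by
    obtain ⟨ε, hε, h⟩ := hVo
    refine ENNReal.toReal_pos ?_ (measure_ne_top _ _)
    exact ((Metric.measure_closedBall_pos μ _ hε).trans_le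
      (measure_mono (h ⟨v, hVO hv⟩ hv))).ne'
  set δ : integers p F := ⟨u, hUO hu⟩ - ⟨v, hVO hv⟩ with hδdef
  have hδ : δ ≠ 0 := by
    intro h
    have : u = v := congrArg Subtype.val (sub_eq_zero.1 h)
    exact Set.disjoint_left.1 hUV hu (this ▸ hv)
  have hdist : ∀ x ∈ U', ∀ y ∈ V', ‖y - x‖ = ‖δ‖ := by
    intro x hx y hy
    have h1 := hU.norm_sub_eq hu hx (Set.disjoint_right.1 hUV hy)
    have h2 := hV.norm_sub_eq hv hy (Set.disjoint_left.1 hUV hu)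
    rw [norm_sub_rev u, h1.symm] at h2
    exact h2
  have hd : (scale μ δ).toReal = normalizedNorm p (u - v) :=
    toReal_scale_integersMeasure p F hδ
  have hd0 : 0 ≤ normalizedNorm p (u - v) := hd ▸ ENNReal.toReal_nonneg
  have hd1 : normalizedNorm p (u - v) ≤ 1 := by
    rw [← hd]
    exact ENNReal.toReal_mono (by simp) (scale_le_one μ δ)
  have hLU : MemLp (Z p U n) 2 (polyMeasure p F n) := by
    rw [Z_eq_ncard hUO]
    exact memLp_ncard_rootsIn μ (by omega) hϖ hUo 2
  have hLV : MemLp (Z p V n) 2 (polyMeasure p F n) := by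
    rw [Z_eq_ncard hVO]
    exact memLp_ncard_rootsIn μ (by omega) hϖ hVo 2
  have hm : (meanScale μ).toReal = q / (q + 1) := by
    rw [hϖ.toReal_meanScale μ, hwq]
    field_simp
  have hEU : ∫ c, Z p U n c ∂(polyMeasure p F n) = μ.real U' * (q / (q + 1)) := by
    rw [Z_eq_ncard hUO, ← hm]
    exact integral_ncard_rootsIn μ (by omega) hϖ hUo
  have hEV : ∫ c, Z p V n c ∂(polyMeasure p F n) = μ.real V' * (q / (q + 1)) := by
    rw [Z_eq_ncard hVO, ← hm]
    exact integral_ncard_rootsIn μ (by omega) hϖ hVo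
  have hEU0 : 0 < ∫ c, Z p U n c ∂(polyMeasure p F n) := by
    rw [hEU]
    positivity
  have hEV0 : 0 < ∫ c, Z p V n c ∂(polyMeasure p F n) := by
    rw [hEV]
    positivity
  have hcov : cov[Z p U n, Z p V n; polyMeasure p F n] =
      (∫ c, Z p U n c ∂(polyMeasure p F n)) * (∫ c, Z p V n c ∂(polyMeasure p F n)) *
        (-1 + (q + 1) ^ 2 / (q ^ 2 + q + 1) * normalizedNorm p (u - v)
          - q / (q ^ 2 + q + 1) * normalizedNorm p (u - v) ^ 4) := by
    have hprod : ∫ c, (Z p U n * Z p V n) c ∂(polyMeasure p F n) =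
        μ.real U' * μ.real V' * ((scale μ δ).toReal * (mixedMoment μ δ).toReal) := by
      rw [Z_eq_ncard hUO, Z_eq_ncard hVO]
      exact integral_ncard_mul_ncard_rootsIn μ hn hϖ hUo hVo hδ hdist
    rw [covariance_eq_sub hLU hLV, hprod, hEU, hEV, hϖ.toReal_mixedMoment μ hδ, hd, hwq]
    field_simp
    ring
  obtain ⟨hle, hiff⟩ := covariance_ratio_nonpos hq2 hd0 hd1
  refine ⟨hprob, ?_, hLU, hLV, hEU0, hEV0, ?_, ?_, ?_⟩
  · rw [hpoly]
    filter_upwards [ae_eventually_simpleRoots_eq μ (by omega) hϖ.ne_zero hϖ.norm_lt_one] with c hc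
    rw [rootCount_eq_encard hUO, rootCount_eq_encard hVO]
    exact ⟨(finite_rootsIn hc.1 _).encard_lt_top.ne, (finite_rootsIn hc.1 _).encard_lt_top.ne⟩
  · rw [hcov, mul_div_cancel_left₀ _ (mul_pos hEU0 hEV0).ne']
  · rw [hcov]
    exact mul_nonpos_of_nonneg_of_nonpos (mul_pos hEU0 hEV0).le hle
  · rw [hcov, mul_eq_zero, or_iff_right (mul_pos hEU0 hEV0).ne', hiff]
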